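/- **Setting.** For $\beta>0$ let $k$ be the greatest integer strictly smaller than $\beta$. For $f:[0,1]\to\mathbb R$ whose derivative $f^{(k)}$ exists put $$\|f\|_{\mathcal H^\beta}=\|f\|_\infty+\|f^{(k)}\|_\infty+\sup_{x\ne y\in[0,1]}\frac{|f^{(k)}(x)-f^{(k)}(y)|}{|x-y|^{\beta-k}}+\max_{1\le j<\beta}\Big(\sup_{x\in[0,1]}\frac{|f^{(j)}(x)|^\beta}{|f(x)|^{\beta-j}}\Big)^{1/j},$$ where $0/0:=0$ and the last term is $0$ if $\beta\le 1$, and let $\mathcal H^\beta$ be the set of all such $f\ge 0$ with $\|f\|_{\mathcal H^\beta}<\infty$. For $f\in\mathcal H^\beta$ with $f>0$ almost everywhere and $\log f\in L^2[0,1]$, let $P_f^n$ be the law of the path $(Y_t)_{t\in[0,1]}$ in the Gaussian white noise model $$dY_t=\tfrac1{\sqrt2}\log f(t)\,dt+n^{-1/2}\,dW_t,\qquad t\in[0,1],\quad Y_0=0,$$ with $W$ a standard Brownian motion. Write $\operatorname{KL}(f,g)$ for the Kullback--Leibler divergence of $P_f^n$ from $P_g^n$, and let $$r^G_{n,\beta}(y)=y\wedge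 (y^2/n)^{\beta/(2\beta+1)},\qquad y\ge 0 .$$ **Theorem.** Let $\beta>0$, $R>0$ and $\rho<R$. There is a constant $C=C(\beta,R,\rho)>0$ such that for every $x_0\in[0,1]$ and every sequence $(f_n^*)_n$ in $\mathcal H^\beta$ with $f_n^*>0$ almost everywhere, $\log f_n^*\in L^2[0,1]$ and $\limsup_{n\to\infty}\|f_n^*\|_{\mathcal H^\beta}\le\rho$, $$\liminf_{n\to\infty}\ \inf_{\hat f_n(x_0)}\ \sup_{f}\ P_f^n\left(\frac{|\hat f_n(x_0)-f(x_0)|}{r^G_{n,\beta}(f(x_0))}\ge C\right)>0 .$$ Here the infimum is over all measurable estimators of $f(x_0)$, that is, all measurable real functions of the path $(Y_t)_{t\in[0,1]}$, and the supremum is over all $f\in\mathcal H^\beta$ with $f>0$ almost everywhere, $\log f\in L^2[0,1]$, $\|f\|_{\mathcal H^\beta}\le R$ and $\operatorname{KL}(f,f_n^*)\le 1$. Functions $f$ with $f(x_0)=0$ (for which the rate is $0$) count as having probability $0$ in the supremum. -/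

import Mathlib

open MeasureTheory ProbabilityTheory Filter
open scoped ENNReal NNReal

namespace LogLinkModel

/-- The greatest integer strictly smaller than `β` (for `β > 0`). -/
noncomputable def holderOrder (β : ℝ) : ℕ := ⌈β⌉₊ - 1

/-- The `j`-th derivative of `f` on `[0,1]` (one-sided at the end points). -/
noncomputable def D (j : ℕ) (f : ℝ → ℝ) (x : ℝ) : ℝ :=
  iteratedDerivWithin j f (Set.Icc 0 1) x

/-- The supremum norm on `[0,1]`. -/
noncomputable def supNorm (g : ℝ → ℝ) : ℝ≥0∞ := ⨆ x ∈ Set.Icc (0 : ℝ) 1, ‖g x‖ₑ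

/-- The Hölder seminorm `|f|_{C^β}` on `[0,1]`. -/
noncomputable def holderSeminorm (β : ℝ) (f : ℝ → ℝ) : ℝ≥0∞ :=
  ⨆ x ∈ Set.Icc (0 : ℝ) 1, ⨆ y ∈ Set.Icc (0 : ℝ) 1, ⨆ _ : x ≠ y,
    ‖D (holderOrder β) f x - D (holderOrder β) f y‖ₑ /
      ENNReal.ofReal (|x - y| ^ (β - (holderOrder β : ℝ)))

/-- The Hölder norm `‖f‖_{C^β}` on `[0,1]`. -/
noncomputable def holderNorm (β : ℝ) (f : ℝ → ℝ) : ℝ≥0∞ :=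
  supNorm f + supNorm (D (holderOrder β) f) + holderSeminorm β f

/-- The flatness seminorm `|f|_{H^β}`: the maximum over the integers `1 ≤ j < β` of
`(sup_x |f^{(j)}(x)|^β / |f(x)|^(β-j))^(1/j)`. The quotient is taken in `[0,∞]`, where
`0 / 0 = 0` and `a / 0 = ∞` for `a > 0`; there is no such `j`, and the value is `0`, for `β ≤ 1`. -/
noncomputable def flatSeminorm (β : ℝ) (f : ℝ → ℝ) : ℝ≥0∞ :=
  ⨆ (j : ℕ) (_ : 1 ≤ j) (_ : (j : ℝ) < β),
    (⨆ x ∈ Set.Icc (0 : ℝ) 1, ‖D j f x‖ₑ ^ β / ‖f x‖ₑ ^ (β - (j : ℝ))) ^ (1 / (j : ℝ))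

/-- The norm `‖f‖_{H^β} = ‖f‖_{C^β} + |f|_{H^β}`. -/
noncomputable def flatNorm (β : ℝ) (f : ℝ → ℝ) : ℝ≥0∞ := holderNorm β f + flatSeminorm β f

/-- The space `H^β` of flat non-negative `β`-Hölder functions on `[0,1]`. Only the values on `[0,1]`
matter. (When the Hölder seminorm is finite, the derivative of order `holderOrder β` is continuous
as soon as it exists, so that `ContDiffOn` only asks for its existence.) -/
structure MemFlat (β : ℝ) (f : ℝ → ℝ) : Prop where
  contDiffOn : ContDiffOn ℝ (holderOrder β : ℕ) f (Set.Icc 0 1)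
  nonneg : ∀ x ∈ Set.Icc (0 : ℝ) 1, 0 ≤ f x
  norm_lt_top : flatNorm β f < ∞

/-- The functions `f` for which `log f` is a genuine square integrable drift on `[0,1]`, that is,
for which the white noise model with drift `2^{-1/2} log f` is defined. Every continuous strictly
positive `f` is one. -/
structure IsLogDrift (f : ℝ → ℝ) : Prop where
  pos : ∀ᵐ x ∂(volume.restrict (Set.Icc (0 : ℝ) 1)), 0 < f x
  memLp : MemLp (fun x => Real.log (f x)) 2 (volume.restrict (Set.Icc (0 : ℝ) 1))

/-- The link function `h(x) = 2^{-1/2} log x`. -/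
noncomputable def link (x : ℝ) : ℝ := Real.log x / √2

/-- The observed path `Y_t = ∫_0^t h(f(s)) ds + n^{-1/2} W_t`, `t ∈ [0,1]`. -/
noncomputable def observation {Ω : Type*} (W : ℝ≥0 → Ω → ℝ) (n : ℕ) (f : ℝ → ℝ) (ω : Ω) :
    unitInterval → ℝ :=
  fun t => (∫ s in (0 : ℝ)..(t : ℝ), link (f s)) + (√(n : ℝ))⁻¹ * W (unitInterval.toNNReal t) ω

/-- The law `P_f^n` of the observed path, on the path space with the σ-algebra generated by the
coordinates. -/
noncomputable def pathLaw {Ω : Type*} [MeasurableSpace Ω] (P : Measure Ω) (W : ℝ≥0 → Ω → ℝ)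
    (n : ℕ) (f : ℝ → ℝ) : Measure (unitInterval → ℝ) :=
  P.map (observation W n f)

/-- The local parameter space `{f : ‖f‖_{H^β} ≤ R, KL(P_f^n, P_g^n) ≤ 1}`. -/
def localSpace {Ω : Type*} [MeasurableSpace Ω] (P : Measure Ω) (W : ℝ≥0 → Ω → ℝ)
    (β R : ℝ) (n : ℕ) (g : ℝ → ℝ) : Set (ℝ → ℝ) :=
  {f | MemFlat β f ∧ IsLogDrift f ∧ flatNorm β f ≤ ENNReal.ofReal R ∧
    InformationTheory.klDiv (pathLaw P W n f) (pathLaw P W n g) ≤ 1}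

/-- The rate `r(y) = y ∧ (y² / n)^(β / (2β+1))`. -/
noncomputable def rate (n : ℕ) (β y : ℝ) : ℝ := min y ((y ^ 2 / n) ^ (β / (2 * β + 1)))

end LogLinkModel

namespace LogLinkModel

open scoped RealInnerProductSpace Topology

/-! The proof is Le Cam's two-point method: two functions of the local space whose path laws are
close, but whose values at `x₀` differ by a multiple of the rate, defeat every estimator
(`one_fourth_le_iSup_pathLaw`).

Closeness of laws reduces to `logDistSq`. By Girsanov (`exists_pathLaw_eq_map_tilted`), changing the
drift tilts the law by a centred Gaussian variable of variance at most `n / 2 * logDistSq`; this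
bounds both the divergence and the probabilities of events. No stochastic integral is needed: the
tilting variable comes from comparing the Gram matrix of Brownian motion with that of the indicators
of `(0, t]`.

The second function is the first plus a bump of height `ε h ^ β` and width `h` at `x₀`. This
scaling, with a bump dominating its own derivatives, keeps the norm increase arbitrarily small
uniformly in `f` (`FlatBump.exists_perturbation`). With `h` a small multiple of `r ^ (1/β)`, where
`r` is the rate at `y = f x₀`, the height is of order `r`. Since `r ≤ y`, flatness keeps `f` above
`y / 2` on the bump (`exists_half_le_of_flatNorm_le`), so the information is of order `n r ^ (2 +
1/β) / y ^ 2`, which the rate keeps bounded.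

If the centre vanishes at `x₀`, a preliminary very narrow bump makes it positive there at negligible
cost (`exists_positive_parameter`). -/

/-! ### Hilbert space representation and recognition of Gaussian laws -/

/-- Two families with equal Gram matrices: every vector `φ` has a representative in the closed span
of the first family with the same scalar products against the family. -/
theorem exists_mem_closedSpan_inner_eq {ι E F : Type*}
    [NormedAddCommGroup E] [InnerProductSpace ℝ E] [CompleteSpace E]
    [NormedAddCommGroup F] [InnerProductSpace ℝ F] [CompleteSpace F]
    (u : ι → E) (v : ι → F) (huv : ∀ i j, ⟪u i, u j⟫ = ⟪v i, v j⟫) (φ : F) :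
    ∃ z ∈ (Submodule.span ℝ (Set.range u)).topologicalClosure,
      ‖z‖ ≤ ‖φ‖ ∧ ∀ i, ⟪z, u i⟫ = ⟪φ, v i⟫ := by
  -- `G` is the graph of the isometry `V` sending `u i` to `v i`; the vector sought is the adjoint
  -- of `V` applied to `φ`.
  set G : Submodule ℝ (WithLp 2 (E × F)) :=
    (Submodule.span ℝ (Set.range fun i => WithLp.toLp 2 (u i, v i))).topologicalClosure with hG
  have hmem : ∀ i, WithLp.toLp 2 (u i, v i) ∈ G := fun i =>
    Submodule.le_topologicalClosure _ (Submodule.subset_span ⟨i, rfl⟩)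
  have horth : ∀ (a : E) (b : F), (∀ i, ⟪a, u i⟫ = ⟪b, v i⟫) → ∀ p ∈ G,
      ⟪a, p.fst⟫ = ⟪b, p.snd⟫ := by
    intro a b hab p hp
    have hle : G ≤ (Submodule.span ℝ {WithLp.toLp 2 (a, -b)})ᗮ := by
      refine Submodule.topologicalClosure_minimal _ ?_ (Submodule.isClosed_orthogonal _)
      rw [Submodule.span_le]
      rintro _ ⟨i, rfl⟩
      rw [SetLike.mem_coe, Submodule.mem_orthogonal_singleton_iff_inner_right]
      simp [WithLp.prod_inner_apply, hab i]
    have h := hle hp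
    rw [Submodule.mem_orthogonal_singleton_iff_inner_right] at h
    simp only [WithLp.prod_inner_apply, inner_neg_left, ← sub_eq_add_neg] at h
    exact sub_eq_zero.1 h
  have hgen : ∀ p ∈ G, ∀ i, ⟪p.fst, u i⟫ = ⟪p.snd, v i⟫ := by
    intro p hp i
    have := horth (u i) (v i) (huv i) p hp
    rwa [real_inner_comm, real_inner_comm (p.snd)] at this
  have hfst : ∀ p ∈ G, p.fst ∈ (Submodule.span ℝ (Set.range u)).topologicalClosure := by
    intro p hp
    have hle : G ≤ ((Submodule.span ℝ (Set.range u)).topologicalClosure).comap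
        (WithLp.fstL 2 ℝ E F : WithLp 2 (E × F) →L[ℝ] E).toLinearMap := by
      refine Submodule.topologicalClosure_minimal _ ?_ ?_
      · rw [Submodule.span_le]
        rintro _ ⟨i, rfl⟩
        exact Submodule.le_topologicalClosure _ (Submodule.subset_span ⟨i, rfl⟩)
      · exact (Submodule.isClosed_topologicalClosure _).preimage
          (WithLp.fstL 2 ℝ E F : WithLp 2 (E × F) →L[ℝ] E).continuous
    exact hle hp
  have : CompleteSpace G := (Submodule.isClosed_topologicalClosure _).completeSpace_coe
  -- Projecting `(0, φ)` onto the graph of an isometry gives half of `(V* φ, V V* φ)`, hence the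
  -- factor `2` below.
  set q : WithLp 2 (E × F) := WithLp.toLp 2 (0, φ) with hq
  set p : WithLp 2 (E × F) := G.starProjection q with hp
  have hpG : p ∈ G := Submodule.starProjection_apply_mem _ _
  have hproj : ∀ r ∈ G, ⟪φ, r.snd⟫ = ⟪p.fst, r.fst⟫ + ⟪p.snd, r.snd⟫ := by
    intro r hr
    have h := Submodule.starProjection_inner_eq_zero (K := G) q r hr
    rw [← hp, inner_sub_left, WithLp.prod_inner_apply, WithLp.prod_inner_apply] at h
    simp only [hq, inner_zero_left, zero_add] at h
    exact sub_eq_zero.1 h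
  have hnorm : ⟪p.fst, p.fst⟫ = ⟪p.snd, p.snd⟫ := horth _ _ (hgen p hpG) p hpG
  refine ⟨(2 : ℝ) • p.fst, Submodule.smul_mem _ _ (hfst p hpG), ?_, ?_⟩
  · have h1 := hproj p hpG
    have h2 := real_inner_le_norm φ p.snd
    rw [real_inner_self_eq_norm_sq, real_inner_self_eq_norm_sq] at h1 hnorm
    have h3 : ‖p.fst‖ = ‖p.snd‖ := by
      rwa [sq_eq_sq₀ (norm_nonneg _) (norm_nonneg _)] at hnorm
    rw [norm_smul, Real.norm_eq_abs, abs_two, h3]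
    rcases (norm_nonneg p.snd).eq_or_lt with h0 | h0
    · rw [← h0]; simp
    · rw [h3] at h1
      nlinarith
  · intro i
    have h1 : ⟪φ, v i⟫ = ⟪p.fst, u i⟫ + ⟪p.snd, v i⟫ := hproj _ (hmem i)
    have h2 := hgen p hpG i
    rw [inner_smul_left, h1, h2, RCLike.conj_to_real]
    ring

/-- The law of a random variable with the moment generating function of a Gaussian. -/
theorem map_eq_gaussianReal_of_mgf {Ω : Type*} [MeasurableSpace Ω] {μ : Measure Ω}
    [IsProbabilityMeasure μ] {X : Ω → ℝ} (hX : AEMeasurable X μ) {m : ℝ} {v : ℝ≥0}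
    (h : ∀ t, mgf X μ t = Real.exp (m * t + v * t ^ 2 / 2)) : μ.map X = gaussianReal m v := by
  have hmgf : mgf X μ = mgf id (gaussianReal m v) := by
    rw [mgf_id_gaussianReal]
    exact funext h
  -- The generating function is finite on the whole line, so the complex one is determined on the
  -- whole plane, and with it the law.
  have hset := integrableExpSet_eq_of_mgf hmgf
  rw [integrableExpSet_id_gaussianReal] at hset
  have hc := eqOn_complexMGF_of_mgf hmgf
  rw [hset] at hc
  have := Measure.ext_of_complexMGF_eq (Y := id) hX aemeasurable_id
    (μ' := gaussianReal m v) (funext fun z => hc (by simp))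
  simpa using this

/-! ### Gaussian subspaces of `L²` and exponential tilting -/

section GaussianSpace

variable {Ω : Type*} [MeasurableSpace Ω] {P : Measure Ω}

/-- The square integrable random variables that are centred Gaussian. -/
def centredGaussians (P : Measure Ω) : Set (Lp ℝ 2 P) :=
  {X | P.map X = gaussianReal 0 (‖X‖₊ ^ 2)}

/-- An `L²` limit is an almost sure limit along a subsequence, so characteristic functions converge
by domination; the Gaussian ones depend continuously on the norm. -/
theorem isClosed_centredGaussians [IsProbabilityMeasure P] : IsClosed (centredGaussians P) := by
  refine IsSeqClosed.isClosed fun X Y hX hXY => ?_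
  have hmeas : TendstoInMeasure P (fun n => (X n : Ω → ℝ)) atTop Y :=
    tendstoInMeasure_of_tendsto_Lp hXY
  obtain ⟨ns, hns, hae⟩ := hmeas.exists_seq_tendsto_ae
  have hmX : ∀ Z : Lp ℝ 2 P, AEMeasurable Z P := fun Z => (Lp.aestronglyMeasurable Z).aemeasurable
  have : IsProbabilityMeasure (P.map Y) := Measure.isProbabilityMeasure_map (hmX Y)
  refine Measure.ext_of_charFun (funext fun t => ?_)
  have hint : ∀ Z : Lp ℝ 2 P,
      charFun (P.map Z) t = ∫ ω, Complex.exp (t * (Z ω : ℝ) * Complex.I) ∂P := by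
    intro Z
    rw [charFun_apply_real, integral_map (hmX Z) (by fun_prop)]
  have h1 : Tendsto (fun k => charFun (P.map (X (ns k))) t) atTop (𝓝 (charFun (P.map Y) t)) := by
    simp_rw [hint]
    refine tendsto_integral_of_dominated_convergence (fun _ => 1) (fun k => ?_)
      (integrable_const _) (fun k => ?_) ?_
    · exact (Measurable.comp_aemeasurable (g := fun x : ℝ => Complex.exp (t * x * Complex.I))
        (by fun_prop) (hmX _)).aestronglyMeasurable
    · refine ae_of_all _ fun ω => ?_
      rw [← Complex.ofReal_mul, Complex.norm_exp_ofReal_mul_I]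
    · filter_upwards [hae] with ω hω
      exact (Continuous.tendsto (f := fun x : ℝ => Complex.exp (t * x * Complex.I))
        (by fun_prop) _).comp hω
  have h2 : Tendsto (fun k => charFun (P.map (X (ns k))) t) atTop
      (𝓝 (charFun (gaussianReal 0 (‖Y‖₊ ^ 2)) t)) := by
    have hk : ∀ k, charFun (P.map (X (ns k))) t = charFun (gaussianReal 0 (‖X (ns k)‖₊ ^ 2)) t :=
      fun k => by rw [hX (ns k)]
    simp_rw [hk, charFun_gaussianReal]
    have hn : Tendsto (fun k => ‖X (ns k)‖) atTop (𝓝 ‖Y‖) :=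
      (hXY.comp hns.tendsto_atTop).norm
    have := (Continuous.tendsto (f := fun r : ℝ => Complex.exp (t * (0:ℝ) * Complex.I -
      (((r ^ 2 : ℝ) : ℂ)) * t ^ 2 / 2)) (by fun_prop) ‖Y‖).comp hn
    simpa [Function.comp_def] using this
  exact tendsto_nhds_unique h1 h2

theorem mgf_of_mem_centredGaussians {X : Lp ℝ 2 P} (hX : X ∈ centredGaussians P) (t : ℝ) :
    mgf X P t = Real.exp (‖X‖ ^ 2 * t ^ 2 / 2) := by
  rw [mgf_gaussianReal hX]
  simp

theorem integrable_exp_of_mem_centredGaussians {X : Lp ℝ 2 P} (hX : X ∈ centredGaussians P) :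
    Integrable (fun ω => Real.exp (X ω)) P := by
  have h := integrable_exp_mul_gaussianReal (μ := 0) (v := ‖X‖₊ ^ 2) 1
  rw [← hX, integrable_map_measure (by fun_prop)
    (Lp.aestronglyMeasurable X).aemeasurable] at h
  simpa [Function.comp_def] using h

theorem integral_exp_of_mem_centredGaussians {X : Lp ℝ 2 P} (hX : X ∈ centredGaussians P) :
    ∫ ω, Real.exp (X ω) ∂P = Real.exp (‖X‖ ^ 2 / 2) := by
  have := mgf_of_mem_centredGaussians hX 1
  simpa [mgf] using this

/-- Exponential tilting by an element of a Gaussian space shifts the means. -/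
theorem map_tilted_of_gaussianSpace [IsProbabilityMeasure P] {K : Submodule ℝ (Lp ℝ 2 P)}
    (hK : (K : Set (Lp ℝ 2 P)) ⊆ centredGaussians P) {Z U : Lp ℝ 2 P} (hZ : Z ∈ K) (hU : U ∈ K) :
    (P.tilted Z).map U = gaussianReal ⟪U, Z⟫ (‖U‖₊ ^ 2) := by
  have hexp := integrable_exp_of_mem_centredGaussians (hK hZ)
  have : IsProbabilityMeasure (P.tilted Z) := isProbabilityMeasure_tilted hexp
  refine map_eq_gaussianReal_of_mgf ((Lp.aestronglyMeasurable U).aemeasurable.mono_ac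
    (tilted_absolutelyContinuous _ _)) fun t => ?_
  -- Since `Z + t U` is again Gaussian, the tilted generating function is the exponential of `(‖Z +
  -- t U‖² - ‖Z‖²) / 2`, whose cross term is the shift of the mean.
  have hmem : Z + t • U ∈ K := K.add_mem hZ (K.smul_mem t hU)
  have hae : (fun ω => Real.exp ((Z + t • U : Lp ℝ 2 P) ω)) =ᵐ[P]
      fun ω => Real.exp (((Z : Ω → ℝ) + fun ω => t * U ω) ω) := by
    filter_upwards [Lp.coeFn_add Z (t • U), Lp.coeFn_smul t U] with ω h1 h2
    rw [h1, Pi.add_apply, Pi.add_apply, h2, Pi.smul_apply, smul_eq_mul]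
  rw [mgf, integral_exp_tilted, ← integral_congr_ae hae,
    integral_exp_of_mem_centredGaussians (hK hmem), integral_exp_of_mem_centredGaussians (hK hZ),
    ← Real.exp_sub]
  congr 1
  rw [norm_add_sq_real, norm_smul, inner_smul_right, real_inner_comm, mul_pow, Real.norm_eq_abs,
    sq_abs]
  simp only [NNReal.coe_pow, coe_nnnorm]
  ring

end GaussianSpace

/-! ### Wiener integrals and the Cameron–Martin theorem -/

section Brownian

variable {Ω : Type*} [MeasurableSpace Ω] {P : Measure Ω} {W : ℝ≥0 → Ω → ℝ}

theorem memLp_two_of_isPreBrownianReal (hB : IsPreBrownianReal W P) (t : ℝ≥0) : MemLp (W t) 2 P :=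
  (hB.isGaussianProcess.hasGaussianLaw_eval t).memLp_two

/-- Brownian motion at time `t` as an element of `L²`. -/
noncomputable def brownianLp (hB : IsPreBrownianReal W P) (t : ℝ≥0) : Lp ℝ 2 P :=
  (memLp_two_of_isPreBrownianReal hB t).toLp (W t)

theorem coeFn_brownianLp (hB : IsPreBrownianReal W P) (t : ℝ≥0) :
    brownianLp hB t =ᵐ[P] W t := MemLp.coeFn_toLp _

theorem inner_brownianLp (hB : IsPreBrownianReal W P) (s t : ℝ≥0) :
    ⟪brownianLp hB s, brownianLp hB t⟫ = min (s : ℝ) t := by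
  have := hB.isGaussianProcess.isProbabilityMeasure
  have h := hB.covariance_eval s t
  rw [covariance_eq_sub (memLp_two_of_isPreBrownianReal hB s) (memLp_two_of_isPreBrownianReal hB t),
    hB.integral_eval, zero_mul, sub_zero] at h
  rw [L2.inner_def, ← NNReal.coe_min, ← h]
  refine integral_congr_ae ?_
  filter_upwards [coeFn_brownianLp hB s, coeFn_brownianLp hB t] with ω h1 h2
  rw [h1, h2]
  simp [mul_comm]

/-- The Gaussian space of a Brownian motion. -/
noncomputable def gaussianSpace (hB : IsPreBrownianReal W P) : Submodule ℝ (Lp ℝ 2 P) :=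
  (Submodule.span ℝ (Set.range (brownianLp hB))).topologicalClosure

/-- Finite combinations of Brownian values are centred Gaussian, and this property is closed in
`L²`. -/
theorem gaussianSpace_subset (hB : IsPreBrownianReal W P) :
    (gaussianSpace hB : Set (Lp ℝ 2 P)) ⊆ centredGaussians P := by
  have := hB.isGaussianProcess.isProbabilityMeasure
  rw [gaussianSpace, Submodule.topologicalClosure_coe]
  refine closure_minimal ?_ isClosed_centredGaussians
  intro X hX
  obtain ⟨c, rfl⟩ := (Finsupp.mem_span_range_iff_exists_finsupp).1 hX
  set X := c.sum fun i a => a • brownianLp hB i with hXdef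
  have hae : (X : Ω → ℝ) =ᵐ[P] fun ω => ∑ t ∈ c.support, c t • W t ω := by
    have h1 : (X : Ω → ℝ) =ᵐ[P] ∑ t ∈ c.support, ⇑(c t • brownianLp hB t) :=
      Lp.coeFn_finsetSum _ _
    have h2 : ∀ᵐ ω ∂P, ∀ t ∈ c.support, (c t • brownianLp hB t : Lp ℝ 2 P) ω = c t • W t ω := by
      rw [Filter.eventually_all_finset]
      intro t _
      filter_upwards [Lp.coeFn_smul (c t) (brownianLp hB t), coeFn_brownianLp hB t] with ω h h'
      rw [h, Pi.smul_apply, h']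
    filter_upwards [h1, h2] with ω h1 h2
    rw [h1, Finset.sum_apply]
    exact Finset.sum_congr rfl h2
  have hgauss : HasGaussianLaw (X : Ω → ℝ) P :=
    ((hB.isGaussianProcess.smul c).hasGaussianLaw_fun_sum (I := c.support)).congr hae.symm
  have hmean : ∫ ω, X ω ∂P = 0 := by
    rw [integral_congr_ae hae, integral_finsetSum (f := fun t ω => c t • W t ω) _
      fun t _ => (hB.integrable_eval t).smul (c t)]
    refine Finset.sum_eq_zero fun t _ => ?_
    rw [integral_smul]
    have := hB.integral_eval t
    simp [this]
  have hvar : Var[X; P] = ‖X‖ ^ 2 := by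
    rw [variance_eq_sub (Lp.memLp X), hmean, ← real_inner_self_eq_norm_sq, L2.inner_def]
    simp [pow_two]
  rw [centredGaussians, Set.mem_ofPred_eq, hgauss.map_eq_gaussianReal, hmean, hvar]
  congr 1
  ext
  simp

/-- Wiener integral: a square integrable drift is represented in the Gaussian space. -/
theorem exists_mem_gaussianSpace (hB : IsPreBrownianReal W P) {φ : ℝ → ℝ} (hφ : MemLp φ 2) :
    ∃ Z ∈ gaussianSpace hB, ‖Z‖ ^ 2 ≤ ∫ x, φ x ^ 2 ∧
      ∀ t : ℝ≥0, ⟪brownianLp hB t, Z⟫ = ∫ s in (0 : ℝ)..t, φ s := by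
  have hfin : ∀ t : ℝ≥0, volume (Set.Ioc (0 : ℝ) t) ≠ ∞ := fun t => by simp
  -- Both `W s, W t` and the indicators of `(0, s]`, `(0, t]` have scalar product `min s t`.
  obtain ⟨Z, hZ, hn, hi⟩ := exists_mem_closedSpan_inner_eq (brownianLp hB)
    (fun t : ℝ≥0 => indicatorConstLp 2 (measurableSet_Ioc (a := (0 : ℝ)) (b := t)) (hfin t) (1 : ℝ))
    (fun s t => by
      rw [inner_brownianLp, L2.inner_indicatorConstLp_indicatorConstLp (hμs := hfin s) (hμt := hfin t)]
      simp [Set.Ioc_inter_Ioc]) (hφ.toLp φ)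
  refine ⟨Z, hZ, ?_, fun t => ?_⟩
  · have h2 : ‖hφ.toLp φ‖ ^ 2 = ∫ x, φ x ^ 2 := by
      rw [← real_inner_self_eq_norm_sq, L2.inner_def]
      refine integral_congr_ae ?_
      filter_upwards [hφ.coeFn_toLp] with x hx
      rw [hx]
      simp [pow_two]
    rw [← h2]
    gcongr
  · rw [real_inner_comm, hi, real_inner_comm, L2.inner_indicatorConstLp_one,
      intervalIntegral.integral_of_le t.coe_nonneg]
    exact integral_congr_ae (ae_restrict_of_ae hφ.coeFn_toLp)

/-- Cameron–Martin: tilting by the Wiener integral of `φ` adds the drift `φ`. -/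
theorem map_tilted_eq_map_add_drift [IsProbabilityMeasure P] (hW : ∀ t, Measurable (W t))
    (hB : IsPreBrownianReal W P) {φ : ℝ → ℝ}
    {Z : Lp ℝ 2 P} (hZ : Z ∈ gaussianSpace hB)
    (hφ : ∀ t : ℝ≥0, ⟪brownianLp hB t, Z⟫ = ∫ s in (0 : ℝ)..t, φ s) :
    (P.tilted Z).map (fun ω (t : ℝ≥0) => W t ω) =
      P.map (fun ω (t : ℝ≥0) => W t ω + ∫ s in (0 : ℝ)..t, φ s) := by
  have : IsProbabilityMeasure (P.tilted Z) := isProbabilityMeasure_tilted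
    (integrable_exp_of_mem_centredGaussians (gaussianSpace_subset hB hZ))
  have hm1 : Measurable (fun ω (t : ℝ≥0) => W t ω) := measurable_pi_lambda _ hW
  have hm2 : Measurable (fun ω (t : ℝ≥0) => W t ω + ∫ s in (0 : ℝ)..t, φ s) :=
    measurable_pi_lambda _ fun t => (hW t).add_const _
  have : IsProbabilityMeasure (P.map (fun ω (t : ℝ≥0) => W t ω + ∫ s in (0 : ℝ)..t, φ s)) :=
    Measure.isProbabilityMeasure_map hm2.aemeasurable
  -- Finite-dimensional marginals determine the law on path space, and by Cramér–Wold it suffices to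
  -- compare their linear functionals, which are one-dimensional Gaussian.
  refine IsProjectiveLimit.unique (P := fun I : Finset ℝ≥0 =>
    (P.map (fun ω (t : ℝ≥0) => W t ω + ∫ s in (0 : ℝ)..t, φ s)).map I.restrict)
    (fun I => ?_) (fun I => rfl)
  have hr : Measurable (I.restrict : (ℝ≥0 → ℝ) → (I → ℝ)) := Finset.measurable_restrict I
  change _ = (P.map (fun ω (t : ℝ≥0) => W t ω + ∫ s in (0 : ℝ)..t, φ s)).map I.restrict
  rw [Measure.map_map hr hm1, Measure.map_map hr hm2]
  have : IsProbabilityMeasure ((P.tilted Z).map (I.restrict ∘ fun ω (t : ℝ≥0) => W t ω)) :=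
    Measure.isProbabilityMeasure_map (hr.comp hm1).aemeasurable
  have : IsProbabilityMeasure
      (P.map (I.restrict ∘ fun ω (t : ℝ≥0) => W t ω + ∫ s in (0 : ℝ)..t, φ s)) :=
    Measure.isProbabilityMeasure_map (hr.comp hm2).aemeasurable
  refine Measure.ext_of_charFunDual (funext fun L => ?_)
  rw [charFunDual_eq_charFun_map_one, charFunDual_eq_charFun_map_one,
    Measure.map_map (by fun_prop) (hr.comp hm1), Measure.map_map (by fun_prop) (hr.comp hm2)]
  congr 1
  classical
  set c : I → ℝ := fun i => L fun j => if i = j then 1 else 0 with hc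
  have hL : ∀ x : I → ℝ, L x = ∑ i, c i * x i := by
    intro x
    have h := LinearMap.pi_apply_eq_sum_univ L.toLinearMap x
    simp only [smul_eq_mul, ContinuousLinearMap.coe_coe] at h
    rw [h]
    exact Finset.sum_congr rfl fun i _ => mul_comm _ _
  set U : Lp ℝ 2 P := ∑ i : I, c i • brownianLp hB i with hU
  have hUmem : U ∈ gaussianSpace hB := Submodule.sum_mem _ fun i _ => Submodule.smul_mem _ _
    (Submodule.le_topologicalClosure _ (Submodule.subset_span ⟨i, rfl⟩))
  have hUae : ∀ᵐ ω ∂P, U ω = ∑ i : I, c i * W i ω := by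
    have h1 : (U : Ω → ℝ) =ᵐ[P] ∑ i : I, ⇑(c i • brownianLp hB i) :=
      Lp.coeFn_finsetSum _ _
    have h2 : ∀ᵐ ω ∂P, ∀ i : I, (c i • brownianLp hB i : Lp ℝ 2 P) ω = c i * W i ω := by
      rw [ae_all_iff]
      intro t
      filter_upwards [Lp.coeFn_smul (c t) (brownianLp hB t), coeFn_brownianLp hB t] with ω h h'
      rw [h, Pi.smul_apply, h', smul_eq_mul]
    filter_upwards [h1, h2] with ω h1 h2
    rw [h1, Finset.sum_apply]
    exact Finset.sum_congr rfl fun i _ => h2 i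
  have hUZ : ⟪U, Z⟫ = ∑ i : I, c i * ∫ s in (0 : ℝ)..(i : ℝ≥0), φ s := by
    rw [hU, sum_inner]
    refine Finset.sum_congr rfl fun i _ => ?_
    rw [inner_smul_left, hφ, RCLike.conj_to_real]
  have e1 : (P.tilted Z).map (L ∘ I.restrict ∘ fun ω (t : ℝ≥0) => W t ω) =
      (P.tilted Z).map U := by
    refine Measure.map_congr ((tilted_absolutelyContinuous P Z).ae_le ?_)
    filter_upwards [hUae] with ω h
    simp [hL, h]
  have e2 : P.map (L ∘ I.restrict ∘ fun ω (t : ℝ≥0) => W t ω + ∫ s in (0 : ℝ)..t, φ s) =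
      (P.map U).map (fun x => x + ⟪U, Z⟫) := by
    rw [AEMeasurable.map_map_of_aemeasurable (by fun_prop)
      (Lp.aestronglyMeasurable U).aemeasurable]
    refine Measure.map_congr ?_
    filter_upwards [hUae] with ω h
    simp [hL, h, hUZ, mul_add, Finset.sum_add_distrib]
  rw [e1, e2, map_tilted_of_gaussianSpace (gaussianSpace_subset hB) hZ hUmem,
    show P.map U = gaussianReal 0 (‖U‖₊ ^ 2) from gaussianSpace_subset hB hUmem,
    gaussianReal_map_add_const, zero_add]

end Brownian

/-! ### Girsanov for the path laws, divergence and change of measure -/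

/-- The squared `L²[0,1]` distance of the logarithms. -/
noncomputable def logDistSq (f g : ℝ → ℝ) : ℝ :=
  ∫ x in Set.Icc (0 : ℝ) 1, (Real.log (f x) - Real.log (g x)) ^ 2

theorem IsLogDrift.memLp_link {f : ℝ → ℝ} (hf : IsLogDrift f) :
    MemLp (fun x => link (f x)) 2 (volume.restrict (Set.Icc (0 : ℝ) 1)) := by
  simpa [link, div_eq_mul_inv, mul_comm] using hf.memLp.const_mul (√2)⁻¹

theorem IsLogDrift.intervalIntegrable_link {f : ℝ → ℝ} (hf : IsLogDrift f) (t : unitInterval) :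
    IntervalIntegrable (fun x => link (f x)) volume 0 t := by
  rw [intervalIntegrable_iff_integrableOn_Icc_of_le t.2.1]
  have h : IntegrableOn (fun x => link (f x)) (Set.Icc 0 1) :=
    hf.memLp_link.integrable (by norm_num)
  exact h.mono_set (Set.Icc_subset_Icc le_rfl t.2.2)

section PathLaw

variable {Ω : Type*} [MeasurableSpace Ω] {P : Measure Ω} [IsProbabilityMeasure P]
  {W : ℝ≥0 → Ω → ℝ} {n : ℕ} {f g : ℝ → ℝ}

omit [IsProbabilityMeasure P] in
theorem measurable_observation (hW : ∀ t, Measurable (W t)) (n : ℕ) (f : ℝ → ℝ) :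
    Measurable (observation W n f) :=
  measurable_pi_lambda _ fun _ => ((hW _).const_mul _).const_add _

/-- Girsanov: the path law for the drift `f` is a Gaussian tilting of the path law for `g`. -/
theorem exists_pathLaw_eq_map_tilted (hW : ∀ t, Measurable (W t)) (hB : IsPreBrownianReal W P)
    (hn : n ≠ 0) (hf : IsLogDrift f) (hg : IsLogDrift g) :
    ∃ Z : Ω → ℝ, ∃ v : ℝ≥0, (v : ℝ) ≤ n / 2 * logDistSq f g ∧ AEMeasurable Z P ∧
      P.map Z = gaussianReal 0 v ∧ (P.tilted Z).map Z = gaussianReal v v ∧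
      pathLaw P W n f = (P.tilted Z).map (observation W n g) := by
  -- Multiplying by `√n` makes the noise standard; the squared `1/√2` of the link gives the factor
  -- `n / 2`.
  set ψ : ℝ → ℝ := fun x => √(n : ℝ) * (link (f x) - link (g x)) with hψ
  have hψ2 : MemLp ψ 2 (volume.restrict (Set.Icc (0 : ℝ) 1)) :=
    (hf.memLp_link.sub hg.memLp_link).const_mul _
  have hφ2 : MemLp (Set.indicator (Set.Icc (0 : ℝ) 1) ψ) 2 :=
    (memLp_indicator_iff_restrict measurableSet_Icc).2 hψ2
  obtain ⟨Z, hZ, hZn, hZi⟩ := exists_mem_gaussianSpace hB hφ2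
  have hsub := gaussianSpace_subset hB
  refine ⟨Z, ‖Z‖₊ ^ 2, ?_, (Lp.aestronglyMeasurable Z).aemeasurable, hsub hZ, ?_, ?_⟩
  · have : ∫ x, Set.indicator (Set.Icc (0 : ℝ) 1) ψ x ^ 2 = n / 2 * logDistSq f g := by
      rw [logDistSq, ← integral_const_mul, ← integral_indicator measurableSet_Icc]
      refine integral_congr_ae (ae_of_all _ fun x => ?_)
      by_cases hx : x ∈ Set.Icc (0 : ℝ) 1
      · simp only [Set.indicator_of_mem hx, hψ, link, mul_pow, Real.sq_sqrt (Nat.cast_nonneg n),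
          ← sub_div, div_pow, Real.sq_sqrt (zero_le_two : (0 : ℝ) ≤ 2)]
        ring
      · simp [Set.indicator_of_notMem hx]
    rw [← this]
    simpa using hZn
  · rw [map_tilted_of_gaussianSpace hsub hZ hZ, real_inner_self_eq_norm_sq]
    simp
  -- `Ψ` builds the observation for `g` out of `W`; fed with `W` plus the drift `ψ`, it yields the
  -- observation for `f`.
  · set Ψ : (ℝ≥0 → ℝ) → (unitInterval → ℝ) := fun w t =>
      (∫ s in (0 : ℝ)..(t : ℝ), link (g s)) + (√(n : ℝ))⁻¹ * w (unitInterval.toNNReal t) with hΨ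
    have hΨm : Measurable Ψ :=
      measurable_pi_lambda _ fun t => ((measurable_pi_apply _).const_mul _).const_add _
    have hn' : √(n : ℝ) ≠ 0 := by positivity
    have hobs : observation W n f = Ψ ∘ fun ω (t : ℝ≥0) =>
        W t ω + ∫ s in (0 : ℝ)..t, Set.indicator (Set.Icc (0 : ℝ) 1) ψ s := by
      ext ω t
      have h1 : ∫ s in (0 : ℝ)..t, Set.indicator (Set.Icc (0 : ℝ) 1) ψ s =
          √(n : ℝ) * ((∫ s in (0 : ℝ)..t, link (f s)) - ∫ s in (0 : ℝ)..t, link (g s)) := by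
        rw [← intervalIntegral.integral_sub (hf.intervalIntegrable_link t)
          (hg.intervalIntegrable_link t), ← intervalIntegral.integral_const_mul]
        refine intervalIntegral.integral_congr fun x hx => ?_
        rw [Set.uIcc_of_le t.2.1] at hx
        exact Set.indicator_of_mem (Set.Icc_subset_Icc le_rfl t.2.2 hx) _
      have h2 : ((unitInterval.toNNReal t : ℝ≥0) : ℝ) = t := rfl
      simp only [observation, hΨ, Function.comp, h2, h1]
      field_simp
      ring
    have hobs' : observation W n g = Ψ ∘ fun ω (t : ℝ≥0) => W t ω := rfl
    rw [pathLaw, hobs, hobs', ← Measure.map_map hΨm (measurable_pi_lambda _ hW),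
      map_tilted_eq_map_add_drift hW hB hZ hZi, Measure.map_map hΨm]
    exact measurable_pi_lambda _ fun t => (hW t).add_const _

/-- The log density is `Z - v / 2`, and `Z` has mean `v` under the tilted measure. -/
theorem klDiv_tilted_le {Z : Ω → ℝ} {v : ℝ≥0} (hZ : AEMeasurable Z P)
    (h0 : P.map Z = gaussianReal 0 v) (h1 : (P.tilted Z).map Z = gaussianReal v v) :
    InformationTheory.klDiv (P.tilted Z) P = ENNReal.ofReal (v / 2) := by
  have hexp : Integrable (fun ω => Real.exp (Z ω)) P := by
    have h := integrable_exp_mul_gaussianReal (μ := 0) (v := v) 1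
    rw [← h0, integrable_map_measure (by fun_prop) hZ] at h
    simpa [Function.comp_def] using h
  have hmgf : ∫ ω, Real.exp (Z ω) ∂P = Real.exp (v / 2) := by
    have := mgf_gaussianReal h0 1
    simpa [mgf] using this
  have : IsProbabilityMeasure (P.tilted Z) := isProbabilityMeasure_tilted hexp
  have hac := tilted_absolutelyContinuous P Z
  have hllr : llr (P.tilted Z) P =ᵐ[P.tilted Z] fun ω => Z ω - v / 2 := by
    have := log_rnDeriv_tilted_left_self hexp
    rw [hmgf, Real.log_exp] at this
    exact hac.ae_le this
  have hZ' : AEMeasurable Z (P.tilted Z) := hZ.mono_ac hac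
  have hint : Integrable Z (P.tilted Z) := by
    have h : Integrable id (gaussianReal (v : ℝ) v) :=
      (memLp_id_gaussianReal 1).integrable (by norm_num)
    rw [← h1, integrable_map_measure (by fun_prop) hZ'] at h
    exact h
  have hmean : ∫ ω, Z ω ∂(P.tilted Z) = v := by
    rw [← integral_id_gaussianReal (μ := (v : ℝ)) (v := v), ← h1,
      integral_map hZ' (by fun_prop)]
  rw [InformationTheory.klDiv_of_ac_of_integrable hac
    ((integrable_congr hllr).2 (hint.sub (integrable_const _))), integral_congr_ae hllr,
    integral_sub hint (integrable_const _), hmean]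
  simp
  ring_nf

/-- Both laws are images under the same observation map, so data processing reduces the claim to the
tilted measure. -/
theorem klDiv_pathLaw_le (hW : ∀ t, Measurable (W t)) (hB : IsPreBrownianReal W P)
    (hn : n ≠ 0) (hf : IsLogDrift f) (hg : IsLogDrift g) :
    InformationTheory.klDiv (pathLaw P W n f) (pathLaw P W n g) ≤
      ENNReal.ofReal (n / 4 * logDistSq f g) := by
  obtain ⟨Z, v, hv, hZ, h0, h1, he⟩ := exists_pathLaw_eq_map_tilted hW hB hn hf hg
  rw [he, pathLaw]
  have : IsFiniteMeasure (P.tilted Z) := by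
    constructor
    have hm : (P.tilted Z).map Z Set.univ = 1 := by rw [h1]; simp
    rw [Measure.map_apply_of_aemeasurable (hZ.mono_ac (tilted_absolutelyContinuous P Z))
      MeasurableSet.univ, Set.preimage_univ] at hm
    simp [hm]
  refine (InformationTheory.klDiv_map_le _ _ (measurable_observation hW n g)).trans ?_
  rw [klDiv_tilted_le hZ h0 h1]
  exact ENNReal.ofReal_le_ofReal (by linarith)

/-- Likelihood ratio bound between the path laws of two close drifts. -/
theorem pathLaw_real_le (hW : ∀ t, Measurable (W t)) (hB : IsPreBrownianReal W P)
    (hn : n ≠ 0) (hf : IsLogDrift f) (hg : IsLogDrift g) (hd : n / 4 * logDistSq f g ≤ 1 / 4)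
    {A : Set (unitInterval → ℝ)} (hA : MeasurableSet A) :
    (pathLaw P W n f).real A ≤ 1 / 2 + (pathLaw P W n g).real A := by
  obtain ⟨Z, v, hv, hZ, h0, h1, he⟩ := exists_pathLaw_eq_map_tilted hW hB hn hf hg
  have hO := measurable_observation hW n g
  set B := observation W n g ⁻¹' A with hBdef
  have hBm : MeasurableSet B := hO hA
  have hv' : (v : ℝ) ≤ 1 / 2 := by linarith
  have hexp : ∀ t : ℝ, Integrable (fun ω => Real.exp (t * Z ω)) P := fun t => by
    have h := integrable_exp_mul_gaussianReal (μ := 0) (v := v) t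
    rw [← h0, integrable_map_measure (by fun_prop) hZ] at h
    simpa [Function.comp_def] using h
  have hmgf : ∀ t : ℝ, ∫ ω, Real.exp (t * Z ω) ∂P = Real.exp (v * t ^ 2 / 2) := fun t => by
    have := mgf_gaussianReal h0 t
    simpa [mgf] using this
  rw [he, pathLaw, map_measureReal_apply hO hA, map_measureReal_apply hO hA, ← hBdef,
    measureReal_def, tilted_apply_eq_ofReal_integral' _ hBm,
    ENNReal.toReal_ofReal (integral_nonneg fun ω => by positivity)]
  have hm1 := hmgf 1
  simp only [one_mul, one_pow, mul_one] at hm1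
  rw [hm1]
  -- For the likelihood ratio `L`, use `L ≤ L² / (2 λ) + λ / 2` with `λ = exp v`, the second moment
  -- of `L`: the first term integrates to at most `1/2`, and `λ ≤ 2` handles the second.
  have hpt : ∀ ω, Real.exp (Z ω) / Real.exp (v / 2) ≤
      Real.exp (-(2 * v)) / 2 * Real.exp (2 * Z ω) + Real.exp v / 2 := by
    intro ω
    rw [← Real.exp_sub]
    have e1 : Real.exp (2 * Z ω) = Real.exp (Z ω - v / 2) ^ 2 * Real.exp v := by
      rw [← Real.exp_nat_mul, ← Real.exp_add]; congr 1; push_cast; ring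
    have e2 : Real.exp (-(2 * v)) = (Real.exp v ^ 2)⁻¹ := by
      rw [← Real.exp_nat_mul, ← Real.exp_neg]; push_cast; rfl
    rw [e1, e2]
    have hp := Real.exp_pos (v : ℝ)
    have : (Real.exp v ^ 2)⁻¹ / 2 * (Real.exp (Z ω - v / 2) ^ 2 * Real.exp v) + Real.exp v / 2 -
        Real.exp (Z ω - v / 2) = (Real.exp (Z ω - v / 2) - Real.exp v) ^ 2 / (2 * Real.exp v) := by
      field_simp
      ring
    have h0 : 0 ≤ (Real.exp (Z ω - v / 2) - Real.exp v) ^ 2 / (2 * Real.exp v) := by positivity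
    linarith
  have hev : Real.exp v ≤ 2 := by
    have h := Real.exp_bound_div_one_sub_of_interval v.coe_nonneg (show (v : ℝ) < 1 by linarith)
    refine h.trans ?_
    rw [div_le_iff₀] <;> linarith
  calc ∫ ω in B, Real.exp (Z ω) / Real.exp (v / 2) ∂P
      ≤ ∫ ω in B, (Real.exp (-(2 * v)) / 2 * Real.exp (2 * Z ω) + Real.exp v / 2) ∂P := by
        refine integral_mono ?_ ?_ hpt
        · have := (hexp 1).integrableOn (s := B)
          simp only [one_mul] at this
          exact this.div_const _
        · exact (((hexp 2).const_mul _).integrableOn).add (integrable_const _)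
    _ = Real.exp (-(2 * v)) / 2 * ∫ ω in B, Real.exp (2 * Z ω) ∂P +
          P.real B * (Real.exp v / 2) := by
        rw [integral_add (((hexp 2).const_mul _).integrableOn) (integrable_const _),
          integral_const_mul, setIntegral_const]
        rfl
    _ ≤ Real.exp (-(2 * v)) / 2 * Real.exp (v * 2 ^ 2 / 2) + P.real B * 1 := by
        gcongr
        · rw [← hmgf 2]
          exact setIntegral_le_integral (hexp 2) (ae_of_all _ fun ω => (Real.exp_pos _).le)
        · linarith
    _ = 1 / 2 + P.real B := by
        rw [div_mul_eq_mul_div, ← Real.exp_add]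
        have : -(2 * (v : ℝ)) + v * 2 ^ 2 / 2 = 0 := by ring
        rw [this, Real.exp_zero, mul_one]

end PathLaw

/-! ### Flat bumps and perturbation of the norm -/

section Perturbation

open scoped ContDiff

theorem holderOrder_lt {β : ℝ} (hβ : 0 < β) : (holderOrder β : ℝ) < β := by
  have h1 : 0 < ⌈β⌉₊ := Nat.ceil_pos.2 hβ
  rw [holderOrder, Nat.cast_sub h1, Nat.cast_one]
  linarith [Nat.ceil_lt_add_one hβ.le]

theorem le_holderOrder_add_one {β : ℝ} (hβ : 0 < β) : β ≤ holderOrder β + 1 := by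
  have h1 : 0 < ⌈β⌉₊ := Nat.ceil_pos.2 hβ
  rw [holderOrder, Nat.cast_sub h1, Nat.cast_one]
  linarith [Nat.le_ceil β]

theorem le_holderOrder_of_lt {β : ℝ} (hβ : 0 < β) {j : ℕ} (hj : (j : ℝ) < β) :
    j ≤ holderOrder β := by
  have h := hj.trans_le (le_holderOrder_add_one hβ)
  exact Nat.lt_succ_iff.1 (by exact_mod_cast h)

/-- The derivatives of a power of a smooth function retain a power of this function. -/
theorem exists_iteratedDeriv_pow_eq {u : ℝ → ℝ} (hu : ContDiff ℝ ∞ u) (m j : ℕ) (hj : j ≤ m) :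
    ∃ c : ℝ → ℝ, ContDiff ℝ ∞ c ∧
      iteratedDeriv j (fun x => u x ^ m) = fun x => c x * u x ^ (m - j) := by
  induction j with
  | zero => exact ⟨fun _ => 1, contDiff_const, by simp⟩
  | succ j ih =>
    obtain ⟨c, hc, he⟩ := ih (by omega)
    obtain ⟨p, hp⟩ : ∃ p, m - j = p + 1 := ⟨m - j - 1, by omega⟩
    refine ⟨fun x => deriv c x * u x + c x * ((p + 1 : ℕ) * deriv u x), ?_, ?_⟩
    · have h1 : ContDiff ℝ ∞ (deriv c) := ((contDiff_infty_iff_deriv).1 hc).2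
      have h2 : ContDiff ℝ ∞ (deriv u) := ((contDiff_infty_iff_deriv).1 hu).2
      exact (h1.mul hu).add (hc.mul (contDiff_const.mul h2))
    · rw [iteratedDeriv_succ, he, hp, show m - (j + 1) = p by omega]
      ext x
      have hcd : DifferentiableAt ℝ c x := (hc.differentiable (by simp)) x
      have hud : DifferentiableAt ℝ u x := (hu.differentiable (by simp)) x
      have := hcd.hasDerivAt.mul (hud.hasDerivAt.pow (p + 1))
      rw [show (fun x => c x * u x ^ (p + 1)) = c * u ^ (p + 1) from rfl, this.deriv]
      simp only [Nat.add_sub_cancel, Pi.pow_apply]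
      ring

/-- A smooth bump function whose derivatives are controlled by its own powers. -/
structure FlatBump (β : ℝ) (K : ℝ → ℝ) (M : ℝ) : Prop where
  contDiff : ContDiff ℝ ∞ K
  nonneg : ∀ x, 0 ≤ K x
  le_one : ∀ x, K x ≤ 1
  eq_one : K 0 = 1
  eq_zero : ∀ x, 1 ≤ |x| → K x = 0
  abs_deriv_le : ∀ j ≤ holderOrder β + 1, ∀ x, |iteratedDeriv j K x| ≤ M
  flat : ∀ j : ℕ, (j : ℝ) < β → ∀ x, |iteratedDeriv j K x| ≤ M * K x ^ ((β - j) / β)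

/-- Take the `m`-th power of a smooth bump `u`: each derivative costs one factor `u`, and `m - j ≥ m
(β - j) / β` as soon as `m ≥ β`. -/
theorem exists_flatBump {β : ℝ} (hβ : 0 < β) : ∃ K M, 0 < M ∧ FlatBump β K M := by
  let b : ContDiffBump (0 : ℝ) := ⟨1 / 2, 1, by norm_num, by norm_num⟩
  set u : ℝ → ℝ := fun x => b x
  have hu : ContDiff ℝ ∞ u := b.contDiff
  have hu0 : ∀ x, 0 ≤ u x := fun x => b.nonneg
  have hu1 : ∀ x, u x ≤ 1 := fun x => b.le_one
  have huz : ∀ x, 1 ≤ |x| → u x = 0 := fun x hx =>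
    b.zero_of_le_dist (by simpa [Real.dist_eq] using hx)
  -- With this `m`, derivatives up to order `holderOrder β + 1` retain a factor `u`, so they vanish
  -- outside `[-1, 1]` and compactness bounds them.
  set m : ℕ := holderOrder β + 2 with hm
  have hmβ : β ≤ m := by
    have := le_holderOrder_add_one hβ
    rw [hm]; push_cast; linarith
  have hc : ∀ j : ℕ, ∃ C : ℝ, 0 ≤ C ∧ (j < m → ∀ x, |iteratedDeriv j (fun x => u x ^ m) x| ≤
      C * u x ^ (m - j)) := by
    intro j
    by_cases hj : j < m
    swap; · exact ⟨0, le_rfl, fun h => absurd h hj⟩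
    obtain ⟨c, hc, he⟩ := exists_iteratedDeriv_pow_eq hu m j hj.le
    obtain ⟨C, hC⟩ := (isCompact_Icc (a := (-1 : ℝ)) (b := 1)).exists_bound_of_continuousOn
      hc.continuous.continuousOn
    refine ⟨max C 0, le_max_right _ _, fun _ x => ?_⟩
    rw [he]
    rcases le_or_gt 1 |x| with hx | hx
    · simp [huz x hx, show m - j ≠ 0 by omega]
    · rw [abs_mul, abs_of_nonneg (pow_nonneg (hu0 x) _)]
      refine mul_le_mul_of_nonneg_right ?_ (pow_nonneg (hu0 x) _)
      exact (hC x (abs_le.1 hx.le)).trans (le_max_left _ _)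
  choose C hC0 hC using hc
  set M : ℝ := ∑ j ∈ Finset.range m, C j + 1 with hM
  have hCM : ∀ j < m, C j ≤ M := fun j hj =>
    (Finset.single_le_sum (fun i _ => hC0 i) (Finset.mem_range.2 hj)).trans (by linarith)
  have hM0 : 0 < M := by
    have : 0 ≤ ∑ j ∈ Finset.range m, C j := Finset.sum_nonneg fun i _ => hC0 i
    linarith
  refine ⟨fun x => u x ^ m, M, hM0, hu.pow m, fun x => pow_nonneg (hu0 x) _,
    fun x => pow_le_one₀ (hu0 x) (hu1 x), ?_, fun x hx => ?_, fun j hj x => ?_, fun j hj x => ?_⟩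
  · have : u 0 = 1 := b.one_of_mem_closedBall (by simp; norm_num [b])
    simp [this]
  · simp [huz x hx, hm]
  · have hjm : j < m := by omega
    refine (hC j hjm x).trans ((mul_le_mul (hCM j hjm) (pow_le_one₀ (hu0 x) (hu1 x))
      (pow_nonneg (hu0 x) _) hM0.le).trans_eq (mul_one M))
  · have hjm : j < m := by have := le_holderOrder_of_lt hβ hj; omega
    refine (hC j hjm x).trans ?_
    have h1 : u x ^ (m - j) ≤ (u x ^ m) ^ ((β - j) / β) := by
      rw [← Real.rpow_natCast, ← Real.rpow_natCast, ← Real.rpow_mul (hu0 x)]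
      refine Real.rpow_le_rpow_of_exponent_ge_of_imp (hu0 x) (hu1 x) ?_ ?_
      · rw [Nat.cast_sub hjm.le, mul_div_assoc', div_le_iff₀ hβ]
        have : (0 : ℝ) ≤ j := Nat.cast_nonneg j
        nlinarith
      · exact fun _ h => absurd h (by exact_mod_cast (by omega : m - j ≠ 0))
    exact mul_le_mul (hCM j hjm) h1 (pow_nonneg (hu0 x) _) hM0.le

/-- The bump of height `a` and width `h` around `x₀`. -/
noncomputable def scaledBump (K : ℝ → ℝ) (x₀ a h : ℝ) (x : ℝ) : ℝ := a * K (h⁻¹ * (x - x₀))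

theorem FlatBump.contDiff_scaledBump {β M : ℝ} {K : ℝ → ℝ} (hK : FlatBump β K M) (x₀ a h : ℝ) :
    ContDiff ℝ ∞ (scaledBump K x₀ a h) :=
  contDiff_const.mul (hK.contDiff.comp (contDiff_const.mul (contDiff_id.sub contDiff_const)))

theorem FlatBump.iteratedDeriv_scaledBump {β M : ℝ} {K : ℝ → ℝ} (hK : FlatBump β K M)
    (x₀ a h : ℝ) (j : ℕ) (x : ℝ) :
    iteratedDeriv j (scaledBump K x₀ a h) x =
      a * (h⁻¹ ^ j * iteratedDeriv j K (h⁻¹ * (x - x₀))) := by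
  have h1 := congrFun (iteratedDeriv_comp_sub_const j (fun z => K (h⁻¹ * z)) x₀) x
  rw [show scaledBump K x₀ a h = fun x => a * K (h⁻¹ * (x - x₀)) from rfl,
    iteratedDeriv_const_mul_field, h1, iteratedDeriv_comp_const_mul (hK.contDiff.of_le (by exact_mod_cast le_top))]

theorem D_add_of_contDiff {j : ℕ} {f g : ℝ → ℝ} (hf : ContDiffOn ℝ j f (Set.Icc 0 1))
    (hg : ContDiff ℝ j g) {x : ℝ} (hx : x ∈ Set.Icc (0 : ℝ) 1) :
    D j (f + g) x = D j f x + iteratedDeriv j g x := by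
  have hu : UniqueDiffOn ℝ (Set.Icc (0 : ℝ) 1) := uniqueDiffOn_Icc zero_lt_one
  rw [D, iteratedDerivWithin_add hx hu (hf x hx) hg.contDiffAt.contDiffWithinAt,
    iteratedDerivWithin_eq_iteratedDeriv hu hg.contDiffAt hx, D]

/-- At `y = 0` both sides force `d = 0`, by the conventions for division by zero in `[0, ∞]`. -/
theorem div_rpow_le_iff {β s d y A : ℝ} (hβ : 0 < β) (hs : 0 < s) (hsβ : s < β) (hy : 0 ≤ y)
    (hA : 0 ≤ A) : ‖d‖ₑ ^ β / ‖y‖ₑ ^ (β - s) ≤ ENNReal.ofReal A ^ s ↔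
      |d| ≤ A ^ (s / β) * y ^ ((β - s) / β) := by
  have hbs : 0 < β - s := by linarith
  rw [ENNReal.div_le_iff_le_mul (Or.inr (ENNReal.rpow_ne_top_of_nonneg hs.le ENNReal.ofReal_ne_top))
    (Or.inl (ENNReal.rpow_ne_top_of_nonneg hbs.le enorm_ne_top)),
    Real.enorm_eq_ofReal_abs, Real.enorm_eq_ofReal hy,
    ENNReal.ofReal_rpow_of_nonneg (abs_nonneg d) hβ.le, ENNReal.ofReal_rpow_of_nonneg hA hs.le,
    ENNReal.ofReal_rpow_of_nonneg hy hbs.le, ← ENNReal.ofReal_mul (by positivity),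
    ENNReal.ofReal_le_ofReal_iff (by positivity),
    ← Real.le_rpow_inv_iff_of_pos (abs_nonneg d) (by positivity) hβ,
    Real.mul_rpow (by positivity) (by positivity), ← Real.rpow_mul hA, ← Real.rpow_mul hy]
  rfl

/-- After taking roots the derivatives enter linearly, so that bounds for a function and for a bump
can be added. -/
theorem flatSeminorm_le_iff {β : ℝ} (hβ : 0 < β) {f : ℝ → ℝ}
    (hf : ∀ x ∈ Set.Icc (0 : ℝ) 1, 0 ≤ f x) {A : ℝ} (hA : 0 ≤ A) :
    flatSeminorm β f ≤ ENNReal.ofReal A ↔ ∀ j : ℕ, 1 ≤ j → (j : ℝ) < β →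
      ∀ x ∈ Set.Icc (0 : ℝ) 1, |D j f x| ≤ A ^ ((j : ℝ) / β) * f x ^ ((β - j) / β) := by
  rw [flatSeminorm]
  simp only [iSup_le_iff]
  refine forall_congr' fun j => forall_congr' fun hj => forall_congr' fun hjβ => ?_
  have hj0 : (0 : ℝ) < j := by exact_mod_cast hj
  rw [one_div, ENNReal.rpow_inv_le_iff hj0]
  simp only [iSup_le_iff]
  exact forall_congr' fun x => forall_congr' fun hx =>
    div_rpow_le_iff hβ hj0 hjβ (hf x hx) hA

namespace FlatBump

variable {β M : ℝ} {K : ℝ → ℝ}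

theorem scaledBump_nonneg (hK : FlatBump β K M) {x₀ a h : ℝ} (ha : 0 ≤ a) (x : ℝ) :
    0 ≤ scaledBump K x₀ a h x := mul_nonneg ha (hK.nonneg _)

theorem scaledBump_le (hK : FlatBump β K M) {x₀ a h : ℝ} (ha : 0 ≤ a) (x : ℝ) :
    scaledBump K x₀ a h x ≤ a := mul_le_of_le_one_right ha (hK.le_one _)

theorem scaledBump_self (hK : FlatBump β K M) (x₀ a h : ℝ) : scaledBump K x₀ a h x₀ = a := by
  simp [scaledBump, hK.eq_one]

theorem scaledBump_eq_zero (hK : FlatBump β K M) {x₀ a h x : ℝ} (hh : 0 < h)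
    (hx : h ≤ |x - x₀|) : scaledBump K x₀ a h x = 0 := by
  rw [scaledBump, hK.eq_zero, mul_zero]
  rwa [abs_mul, abs_of_pos (inv_pos.2 hh), le_inv_mul_iff₀ hh, mul_one]

/-- The mean value inequality serves for points at distance at most `1`, the uniform bound for the
others. -/
theorem abs_sub_iteratedDeriv_le (hβ : 0 < β) (hM : 0 < M) (hK : FlatBump β K M) (s t : ℝ) :
    |iteratedDeriv (holderOrder β) K s - iteratedDeriv (holderOrder β) K t| ≤
      2 * M * |s - t| ^ (β - holderOrder β) := by
  set k := holderOrder β with hk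
  have hθ0 : 0 < β - k := sub_pos.2 (holderOrder_lt hβ)
  have hθ1 : β - k ≤ 1 := by linarith [le_holderOrder_add_one hβ]
  rcases le_total |s - t| 1 with hst | hst
  · have hd : ∀ x ∈ (Set.univ : Set ℝ), DifferentiableAt ℝ (iteratedDeriv k K) x := fun x _ =>
      hK.contDiff.differentiable_iteratedDeriv k (by exact_mod_cast ENat.natCast_lt_top k) x
    have hlip := Convex.norm_image_sub_le_of_norm_deriv_le (C := M) hd (fun x _ => by
      rw [← iteratedDeriv_succ]
      exact hK.abs_deriv_le _ le_rfl x) convex_univ (Set.mem_univ t) (Set.mem_univ s)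
    rw [Real.norm_eq_abs, Real.norm_eq_abs] at hlip
    have h1 : |s - t| ≤ |s - t| ^ (β - k) := by
      conv_lhs => rw [← Real.rpow_one |s - t|]
      exact Real.rpow_le_rpow_of_exponent_ge_of_imp (abs_nonneg _) hst hθ1
        (fun _ h => absurd h one_ne_zero)
    have h2 : M * |s - t| ≤ M * |s - t| ^ (β - k) := by gcongr
    have h3 : 0 ≤ M * |s - t| ^ (β - k) := by positivity
    linarith
  · have h1 : 1 ≤ |s - t| ^ (β - k) := Real.one_le_rpow hst hθ0.le
    have h2 := abs_sub (iteratedDeriv k K s) (iteratedDeriv k K t)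
    have h3 := hK.abs_deriv_le k (by omega) s
    have h4 := hK.abs_deriv_le k (by omega) t
    nlinarith

variable {x₀ ε h : ℝ}

theorem abs_iteratedDeriv_scaledBump_le (hβ : 0 < β) (hK : FlatBump β K M)
    (hε : 0 < ε) (hh : 0 < h) (hh1 : h ≤ 1) (x : ℝ) :
    |iteratedDeriv (holderOrder β) (scaledBump K x₀ (ε * h ^ β) h) x| ≤ ε * M := by
  set k := holderOrder β with hk
  have hθ0 : 0 < β - k := sub_pos.2 (holderOrder_lt hβ)
  rw [hK.iteratedDeriv_scaledBump, ← mul_assoc, inv_pow, mul_assoc ε, ← div_eq_mul_inv,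
    ← Real.rpow_sub_natCast hh.ne', abs_mul, abs_of_pos (by positivity)]
  have h1 : h ^ (β - k) ≤ 1 := Real.rpow_le_one hh.le hh1 hθ0.le
  exact mul_le_mul (mul_le_of_le_one_right hε.le h1) (hK.abs_deriv_le k (by omega) _)
    (abs_nonneg _) hε.le

/-- The amplitude `h ^ β` makes the Hölder seminorm independent of `h`: it cancels the scaling of
the derivative and of the distance. -/
theorem abs_sub_iteratedDeriv_scaledBump_le (hβ : 0 < β) (hM : 0 < M) (hK : FlatBump β K M)
    (hε : 0 < ε) (hh : 0 < h) (x y : ℝ) :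
    |iteratedDeriv (holderOrder β) (scaledBump K x₀ (ε * h ^ β) h) x -
      iteratedDeriv (holderOrder β) (scaledBump K x₀ (ε * h ^ β) h) y| ≤
      2 * M * ε * |x - y| ^ (β - holderOrder β) := by
  have hlip := hK.abs_sub_iteratedDeriv_le hβ hM (h⁻¹ * (x - x₀)) (h⁻¹ * (y - x₀))
  set k := holderOrder β with hk
  have hθ0 : 0 < β - k := sub_pos.2 (holderOrder_lt hβ)
  rw [hK.iteratedDeriv_scaledBump, hK.iteratedDeriv_scaledBump, ← mul_sub, ← mul_sub, ← mul_assoc,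
    inv_pow, mul_assoc ε, ← div_eq_mul_inv, ← Real.rpow_sub_natCast hh.ne', abs_mul,
    abs_of_pos (by positivity)]
  rw [← mul_sub, sub_sub_sub_cancel_right, abs_mul, abs_of_pos (inv_pos.2 hh),
    Real.mul_rpow (by positivity) (by positivity), Real.inv_rpow hh.le] at hlip
  have hp : 0 < h ^ (β - k) := by positivity
  calc _ ≤ ε * h ^ (β - k) * (2 * M * ((h ^ (β - k))⁻¹ * |x - y| ^ (β - k))) := by gcongr
    _ = _ := by field_simp

/-- The flatness bound is also scale invariant; splitting `ε` into its powers `j / β` and `(β - j) /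
β` leaves a small constant. -/
theorem abs_iteratedDeriv_scaledBump_le_rpow (hβ : 0 < β) (hK : FlatBump β K M)
    (hε : 0 < ε) (hh : 0 < h) {j : ℕ} (hj : (j : ℝ) < β) (x : ℝ) :
    |iteratedDeriv j (scaledBump K x₀ (ε * h ^ β) h) x| ≤
      ε ^ ((j : ℝ) / β) * M * scaledBump K x₀ (ε * h ^ β) h x ^ ((β - j) / β) := by
  have hflat := hK.flat j hj (h⁻¹ * (x - x₀))
  rw [hK.iteratedDeriv_scaledBump, ← mul_assoc, inv_pow, mul_assoc ε, ← div_eq_mul_inv,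
    ← Real.rpow_sub_natCast hh.ne', abs_mul, abs_of_pos (by positivity), scaledBump,
    Real.mul_rpow (by positivity) (hK.nonneg _), Real.mul_rpow hε.le (by positivity),
    ← Real.rpow_mul hh.le, mul_div_cancel₀ _ hβ.ne']
  have he : ε ^ ((j : ℝ) / β) * ε ^ ((β - j) / β) = ε := by
    rw [← Real.rpow_add hε, ← add_div, add_sub_cancel, div_self hβ.ne', Real.rpow_one]
  calc _ ≤ ε * h ^ (β - j) * (M * K (h⁻¹ * (x - x₀)) ^ ((β - j) / β)) := by gcongr
    _ = (ε ^ ((j : ℝ) / β) * ε ^ ((β - j) / β)) * h ^ (β - j) *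
        (M * K (h⁻¹ * (x - x₀)) ^ ((β - j) / β)) := by rw [he]
    _ = _ := by ring

end FlatBump

/-- On the compact interval `[0, R]` the continuous gap `(A + η) ^ s - A ^ s` has a positive
minimum, so one `ε` serves all functions of bounded flatness. -/
theorem eventually_rpow_add_le {s η R : ℝ} (hs : 0 < s) (hη : 0 < η) (hR : 0 ≤ R) (M : ℝ) :
    ∀ᶠ ε in 𝓝[>] (0 : ℝ), ∀ A ∈ Set.Icc 0 R, A ^ s + ε ^ s * M ≤ (A + η) ^ s := by
  have hcont : Continuous fun A : ℝ => (A + η) ^ s - A ^ s :=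
    ((continuous_id.add continuous_const).rpow_const fun _ => Or.inr hs.le).sub
      (continuous_id.rpow_const fun _ => Or.inr hs.le)
  obtain ⟨A₀, hA₀, hmin⟩ := (isCompact_Icc (a := (0 : ℝ)) (b := R)).exists_isMinOn
    ⟨0, le_rfl, hR⟩ hcont.continuousOn
  have hpos : 0 < (A₀ + η) ^ s - A₀ ^ s :=
    sub_pos.2 (Real.rpow_lt_rpow hA₀.1 (by linarith) hs)
  have hlim : Tendsto (fun ε : ℝ => ε ^ s * M) (𝓝[>] 0) (𝓝 0) := by
    have h : Continuous fun ε : ℝ => ε ^ s * M :=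
      (continuous_id.rpow_const fun _ => Or.inr hs.le).mul continuous_const
    have := h.tendsto 0
    rw [Real.zero_rpow hs.ne', zero_mul] at this
    exact this.mono_left nhdsWithin_le_nhds
  filter_upwards [hlim.eventually (gt_mem_nhds hpos)] with ε hε A hA
  have := hmin hA
  simp only [Set.mem_ofPred_eq] at this
  linarith

theorem holderSeminorm_add_le {β c : ℝ} {f g p : ℝ → ℝ}
    (hg : ∀ x ∈ Set.Icc (0 : ℝ) 1, D (holderOrder β) g x = D (holderOrder β) f x + p x)
    (hp : ∀ x y, |p x - p y| ≤ c * |x - y| ^ (β - holderOrder β)) (hc : 0 ≤ c) :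
    holderSeminorm β g ≤ holderSeminorm β f + ENNReal.ofReal c := by
  rw [holderSeminorm]
  refine iSup₂_le fun x hx => iSup₂_le fun y hy => iSup_le fun hxy => ?_
  rw [hg x hx, hg y hy, add_sub_add_comm]
  refine (ENNReal.div_le_div_right (enorm_add_le _ _) _).trans ?_
  rw [ENNReal.add_div]
  refine add_le_add ?_ ?_
  · rw [holderSeminorm]
    exact le_iSup₂_of_le x hx (le_iSup₂_of_le y hy (le_iSup_of_le hxy le_rfl))
  · refine ENNReal.div_le_of_le_mul ?_
    rw [← ENNReal.ofReal_mul hc, Real.enorm_eq_ofReal_abs]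
    exact ENNReal.ofReal_le_ofReal (hp x y)

theorem supNorm_add_le {c : ℝ} {f g p : ℝ → ℝ}
    (hg : ∀ x ∈ Set.Icc (0 : ℝ) 1, g x = f x + p x) (hp : ∀ x, |p x| ≤ c) :
    supNorm g ≤ supNorm f + ENNReal.ofReal c := by
  rw [supNorm]
  refine iSup₂_le fun x hx => ?_
  rw [hg x hx]
  refine (enorm_add_le _ _).trans (add_le_add ?_ ?_)
  · rw [supNorm]
    exact le_iSup₂_of_le x hx le_rfl
  · rw [Real.enorm_eq_ofReal_abs]
    exact ENNReal.ofReal_le_ofReal (hp x)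

/-- Small rescaled bumps increase the norm of flat functions by an arbitrarily small amount, in a
uniform way. -/
theorem FlatBump.exists_perturbation {β M R η : ℝ} {K : ℝ → ℝ} (hβ : 0 < β) (hM : 0 < M)
    (hK : FlatBump β K M) (hR : 0 ≤ R) (hη : 0 < η) :
    ∃ ε : ℝ, 0 < ε ∧ ε ≤ 1 ∧ ∀ f, MemFlat β f → flatNorm β f ≤ ENNReal.ofReal R →
      ∀ x₀ h, 0 < h → h ≤ 1 → MemFlat β (f + scaledBump K x₀ (ε * h ^ β) h) ∧
        flatNorm β (f + scaledBump K x₀ (ε * h ^ β) h) ≤ flatNorm β f + ENNReal.ofReal η := by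
  have hev1 : ∀ᶠ ε in 𝓝[>] (0 : ℝ), ∀ j ∈ Finset.Icc 1 (holderOrder β),
      ∀ A ∈ Set.Icc 0 R, A ^ ((j : ℝ) / β) + ε ^ ((j : ℝ) / β) * M ≤
        (A + η / 2) ^ ((j : ℝ) / β) := by
    rw [Filter.eventually_all_finset]
    intro j hj
    have hj0 : (0 : ℝ) < j := by exact_mod_cast (Finset.mem_Icc.1 hj).1
    exact eventually_rpow_add_le (by positivity) (by linarith) hR M
  -- The three Hölder terms grow by `ε`, `ε M` and `2 M ε`, sharing `η / 2`; the other half is for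
  -- the flatness seminorm.
  have hδ : 0 < min 1 (η / 2 / (1 + M + 2 * M)) := by positivity
  have hev2 : ∀ᶠ ε in 𝓝[>] (0 : ℝ), ε ∈ Set.Ioo 0 (min 1 (η / 2 / (1 + M + 2 * M))) :=
    Ioo_mem_nhdsGT hδ
  obtain ⟨ε, hflat, hε0, hε1⟩ := (hev1.and hev2).exists
  have hε2 : ε * (1 + M + 2 * M) ≤ η / 2 :=
    (le_div_iff₀ (by positivity)).1 (hε1.le.trans (min_le_right _ _))
  refine ⟨ε, hε0, hε1.le.trans (min_le_left _ _), fun f hf hfR x₀ h hh hh1 => ?_⟩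
  set p := scaledBump K x₀ (ε * h ^ β) h with hp
  have ha : 0 ≤ ε * h ^ β := by positivity
  have hpc := hK.contDiff_scaledBump x₀ (ε * h ^ β) h
  have hpc' : ∀ j : ℕ, ContDiff ℝ j p := fun j => hpc.of_le (by exact_mod_cast le_top)
  have hp0 : ∀ x, 0 ≤ p x := fun x => hK.scaledBump_nonneg ha x
  have hD : ∀ j ≤ holderOrder β, ∀ x ∈ Set.Icc (0 : ℝ) 1,
      D j (f + p) x = D j f x + iteratedDeriv j p x := fun j hj x hx =>
    D_add_of_contDiff (hf.contDiffOn.of_le (by exact_mod_cast hj)) (hpc' j) hx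
  have h1 : supNorm (f + p) ≤ supNorm f + ENNReal.ofReal ε := by
    refine supNorm_add_le (fun x _ => rfl) fun x => ?_
    rw [abs_of_nonneg (hp0 x)]
    exact (hK.scaledBump_le ha x).trans
      (mul_le_of_le_one_right hε0.le (Real.rpow_le_one hh.le hh1 hβ.le))
  have h2 : supNorm (D (holderOrder β) (f + p)) ≤
      supNorm (D (holderOrder β) f) + ENNReal.ofReal (ε * M) :=
    supNorm_add_le (hD _ le_rfl) (hK.abs_iteratedDeriv_scaledBump_le hβ hε0 hh hh1)
  have h3 : holderSeminorm β (f + p) ≤ holderSeminorm β f + ENNReal.ofReal (2 * M * ε) :=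
    holderSeminorm_add_le (hD _ le_rfl) (hK.abs_sub_iteratedDeriv_scaledBump_le hβ hM hε0 hh)
      (by positivity)
  have hg0 : ∀ x ∈ Set.Icc (0 : ℝ) 1, 0 ≤ (f + p) x := fun x hx =>
    add_nonneg (hf.nonneg x hx) (hp0 x)
  have h4 : flatSeminorm β (f + p) ≤ flatSeminorm β f + ENNReal.ofReal (η / 2) := by
    have hle : flatSeminorm β f ≤ ENNReal.ofReal R := le_add_self.trans hfR
    have hfin : flatSeminorm β f ≠ ⊤ := ne_top_of_le_ne_top ENNReal.ofReal_ne_top hle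
    obtain ⟨A, hA0, hA⟩ : ∃ A : ℝ, 0 ≤ A ∧ flatSeminorm β f = ENNReal.ofReal A :=
      ⟨_, ENNReal.toReal_nonneg, (ENNReal.ofReal_toReal hfin).symm⟩
    have hAR : A ≤ R := by rwa [hA, ENNReal.ofReal_le_ofReal_iff hR] at hle
    rw [hA, ← ENNReal.ofReal_add hA0 (by positivity), flatSeminorm_le_iff hβ hg0 (by positivity)]
    intro j hj hjβ x hx
    have hjk := le_holderOrder_of_lt hβ hjβ
    have hf1 := (flatSeminorm_le_iff hβ hf.nonneg hA0).1 hA.le j hj hjβ x hx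
    have hp1 := hK.abs_iteratedDeriv_scaledBump_le_rpow (x₀ := x₀) hβ hε0 hh hjβ x
    have hexp : 0 ≤ (β - j) / β := div_nonneg (by linarith) hβ.le
    -- Nonnegativity of both summands is essential: each bound can be weakened to the same power of
    -- `f + p`, and the constants add up.
    have hmf : f x ^ ((β - j) / β) ≤ (f + p) x ^ ((β - j) / β) :=
      Real.rpow_le_rpow (hf.nonneg x hx) (le_add_of_nonneg_right (hp0 x)) hexp
    have hmp : p x ^ ((β - j) / β) ≤ (f + p) x ^ ((β - j) / β) :=
      Real.rpow_le_rpow (hp0 x) (le_add_of_nonneg_left (hf.nonneg x hx)) hexp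
    rw [hD j hjk x hx]
    calc |D j f x + iteratedDeriv j p x| ≤ |D j f x| + |iteratedDeriv j p x| := abs_add_le _ _
      _ ≤ A ^ ((j : ℝ) / β) * (f + p) x ^ ((β - j) / β) +
          ε ^ ((j : ℝ) / β) * M * (f + p) x ^ ((β - j) / β) :=
        add_le_add (hf1.trans (by gcongr)) (hp1.trans (by gcongr))
      _ = (A ^ ((j : ℝ) / β) + ε ^ ((j : ℝ) / β) * M) * (f + p) x ^ ((β - j) / β) := by ring
      _ ≤ _ := mul_le_mul_of_nonneg_right (hflat j (Finset.mem_Icc.2 ⟨hj, hjk⟩) A ⟨hA0, hAR⟩)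
        (Real.rpow_nonneg (hg0 x hx) _)
  have hnorm : flatNorm β (f + p) ≤ flatNorm β f + ENNReal.ofReal η := by
    have hsum : ENNReal.ofReal ε + ENNReal.ofReal (ε * M) + ENNReal.ofReal (2 * M * ε) +
        ENNReal.ofReal (η / 2) ≤ ENNReal.ofReal η := by
      rw [← ENNReal.ofReal_add hε0.le (by positivity), ← ENNReal.ofReal_add (by positivity)
        (by positivity), ← ENNReal.ofReal_add (by positivity) (by positivity)]
      exact ENNReal.ofReal_le_ofReal (by linarith)
    calc flatNorm β (f + p) ≤ (supNorm f + ENNReal.ofReal ε) +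
          (supNorm (D (holderOrder β) f) + ENNReal.ofReal (ε * M)) +
          (holderSeminorm β f + ENNReal.ofReal (2 * M * ε)) +
          (flatSeminorm β f + ENNReal.ofReal (η / 2)) := by
          rw [flatNorm, holderNorm]; gcongr
      _ = flatNorm β f + (ENNReal.ofReal ε + ENNReal.ofReal (ε * M) +
          ENNReal.ofReal (2 * M * ε) + ENNReal.ofReal (η / 2)) := by
          rw [flatNorm, holderNorm]; ring
      _ ≤ _ := by gcongr
  exact ⟨⟨hf.contDiffOn.add (hpc' _).contDiffOn, hg0,
    hnorm.trans_lt (ENNReal.add_lt_top.2 ⟨hf.norm_lt_top, ENNReal.ofReal_lt_top⟩)⟩, hnorm⟩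

end Perturbation

/-! ### Local variation of flat functions -/

theorem abs_sub_le_of_holderSeminorm_le {β R : ℝ} (hβ : 0 < β) (hβ1 : β ≤ 1) (hR : 0 ≤ R)
    {f : ℝ → ℝ} (hf : holderSeminorm β f ≤ ENNReal.ofReal R) {x y : ℝ}
    (hx : x ∈ Set.Icc (0 : ℝ) 1) (hy : y ∈ Set.Icc (0 : ℝ) 1) : |f x - f y| ≤ R * |x - y| ^ β := by
  have hk : holderOrder β = 0 := by
    rw [holderOrder, Nat.sub_eq_zero_iff_le]
    exact Nat.ceil_le.2 (by simpa using hβ1)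
  rcases eq_or_ne x y with rfl | hxy
  · simp [Real.zero_rpow hβ.ne']
  have h1 : ‖D (holderOrder β) f x - D (holderOrder β) f y‖ₑ /
      ENNReal.ofReal (|x - y| ^ (β - (holderOrder β : ℝ))) ≤ ENNReal.ofReal R := by
    refine le_trans ?_ hf
    rw [holderSeminorm]
    exact le_iSup₂_of_le x hx (le_iSup₂_of_le y hy (le_iSup_of_le hxy le_rfl))
  have hpos : 0 < |x - y| := abs_pos.2 (sub_ne_zero.2 hxy)
  simp only [hk, D, iteratedDerivWithin_zero, Nat.cast_zero, sub_zero] at h1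
  rw [ENNReal.div_le_iff_le_mul (Or.inr ENNReal.ofReal_ne_top) (Or.inl ENNReal.ofReal_ne_top),
    ← ENNReal.ofReal_mul hR, Real.enorm_eq_ofReal_abs,
    ENNReal.ofReal_le_ofReal_iff (by positivity)] at h1
  exact h1

/-- For flat functions of smoothness `β > 1`, the power `f^{1/β}` is Lipschitz. -/
theorem rpow_sub_rpow_le_of_flatSeminorm_le {β R : ℝ} (hβ1 : 1 < β) (hR : 0 ≤ R)
    {f : ℝ → ℝ} (hf : MemFlat β f) (hfR : flatSeminorm β f ≤ ENNReal.ofReal R) {x y : ℝ}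
    (hx : x ∈ Set.Icc (0 : ℝ) 1) (hy : y ∈ Set.Icc (0 : ℝ) 1) :
    f y ^ β⁻¹ - f x ^ β⁻¹ ≤ R ^ β⁻¹ * |x - y| := by
  have hβ : 0 < β := by linarith
  have hk : 1 ≤ holderOrder β := le_holderOrder_of_lt hβ (by simpa using hβ1)
  have hdiff : DifferentiableOn ℝ f (Set.Icc 0 1) :=
    hf.contDiffOn.differentiableOn (by exact_mod_cast (by omega : holderOrder β ≠ 0))
  have hder := (flatSeminorm_le_iff hβ hf.nonneg hR).1 hfR 1 le_rfl (by simpa using hβ1)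
  -- The shift by `δ` avoids zeros of `f`, where the root is not differentiable. Flatness for `j =
  -- 1` cancels the factor from the chain rule.
  have hδ : ∀ δ : ℝ, 0 < δ → (f y + δ) ^ β⁻¹ - (f x + δ) ^ β⁻¹ ≤ R ^ β⁻¹ * |x - y| := by
    intro δ hδ
    have hpos : ∀ z ∈ Set.Icc (0 : ℝ) 1, 0 < f z + δ := fun z hz => by
      have := hf.nonneg z hz
      linarith
    have hd : ∀ z ∈ Set.Icc (0 : ℝ) 1, HasDerivWithinAt (fun z => (f z + δ) ^ β⁻¹)
        (derivWithin f (Set.Icc 0 1) z * β⁻¹ * (f z + δ) ^ (β⁻¹ - 1)) (Set.Icc 0 1) z :=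
      fun z hz => ((hdiff z hz).hasDerivWithinAt.add_const δ).rpow_const (Or.inl (hpos z hz).ne')
    have hb : ∀ z ∈ Set.Icc (0 : ℝ) 1,
        ‖derivWithin f (Set.Icc 0 1) z * β⁻¹ * (f z + δ) ^ (β⁻¹ - 1)‖ ≤ R ^ β⁻¹ := by
      intro z hz
      have h1 := hder z hz
      simp only [D, iteratedDerivWithin_one, Nat.cast_one, one_div] at h1
      have h2 : f z ^ ((β - 1) / β) ≤ (f z + δ) ^ ((β - 1) / β) :=
        Real.rpow_le_rpow (hf.nonneg z hz) (by linarith) (div_nonneg (by linarith) hβ.le)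
      have h3 : (f z + δ) ^ ((β - 1) / β) * (f z + δ) ^ (β⁻¹ - 1) = 1 := by
        rw [← Real.rpow_add (hpos z hz)]
        have : (β - 1) / β + (β⁻¹ - 1) = 0 := by field_simp; ring
        rw [this, Real.rpow_zero]
      have h4 : 0 < (f z + δ) ^ (β⁻¹ - 1) := Real.rpow_pos_of_pos (hpos z hz) _
      have h5 : 0 ≤ R ^ β⁻¹ := Real.rpow_nonneg hR _
      rw [Real.norm_eq_abs, abs_mul, abs_mul, abs_of_pos h4, abs_of_pos (inv_pos.2 hβ)]
      calc |derivWithin f (Set.Icc 0 1) z| * β⁻¹ * (f z + δ) ^ (β⁻¹ - 1)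
          ≤ (R ^ β⁻¹ * (f z + δ) ^ ((β - 1) / β)) * 1 * (f z + δ) ^ (β⁻¹ - 1) := by
            gcongr
            · exact mul_nonneg h5 (Real.rpow_nonneg (hpos z hz).le _)
            · exact h1.trans (by gcongr)
            · exact inv_le_one_of_one_le₀ hβ1.le
        _ = R ^ β⁻¹ * ((f z + δ) ^ ((β - 1) / β) * (f z + δ) ^ (β⁻¹ - 1)) := by ring
        _ = R ^ β⁻¹ := by rw [h3, mul_one]
    have := (convex_Icc (0 : ℝ) 1).norm_image_sub_le_of_norm_hasDerivWithin_le hd hb hx hy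
    rw [Real.norm_eq_abs, Real.norm_eq_abs, abs_sub_comm y x] at this
    exact (le_abs_self _).trans this
  have hlim : Tendsto (fun δ => (f y + δ) ^ β⁻¹ - (f x + δ) ^ β⁻¹) (𝓝[>] 0)
      (𝓝 (f y ^ β⁻¹ - f x ^ β⁻¹)) := by
    have hc : ∀ z, Continuous fun δ : ℝ => (f z + δ) ^ β⁻¹ := fun z =>
      (continuous_const.add continuous_id).rpow_const fun _ => Or.inr (inv_pos.2 hβ).le
    have := ((hc y).sub (hc x)).tendsto 0
    simp only [Pi.sub_apply, add_zero] at this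
    exact this.mono_left nhdsWithin_le_nhds
  exact le_of_tendsto hlim (eventually_mem_nhdsWithin.mono fun δ hδ' => hδ δ hδ')

/-- Flat functions do not vary much at the scale `f(x₀)^{1/β}` around `x₀`. -/
theorem exists_half_le_of_flatNorm_le {β R : ℝ} (hβ : 0 < β) (hR : 0 < R) :
    ∃ c : ℝ, 0 < c ∧ ∀ f, MemFlat β f → flatNorm β f ≤ ENNReal.ofReal R →
      ∀ x₀ ∈ Set.Icc (0 : ℝ) 1, ∀ x ∈ Set.Icc (0 : ℝ) 1, |x - x₀| ≤ c * f x₀ ^ β⁻¹ →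
        f x₀ / 2 ≤ f x := by
  rcases le_or_gt β 1 with hβ1 | hβ1
  -- Chosen so that the Hölder bound is exactly `f x₀ / 2`.
  · refine ⟨(1 / (2 * R)) ^ β⁻¹, by positivity, fun f hf hfR x₀ hx₀ x hx hd => ?_⟩
    have h0 := hf.nonneg x₀ hx₀
    have hs : holderSeminorm β f ≤ ENNReal.ofReal R :=
      (le_add_self.trans (le_self_add (a := holderNorm β f))).trans hfR
    have h1 := abs_sub_le_of_holderSeminorm_le hβ hβ1 hR.le hs hx hx₀
    have h2 : |x - x₀| ^ β ≤ 1 / (2 * R) * f x₀ := by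
      rw [← Real.mul_rpow (by positivity) h0] at hd
      exact (Real.le_rpow_inv_iff_of_pos (abs_nonneg _) (by positivity) hβ).1 hd
    have h3 : R * |x - x₀| ^ β ≤ f x₀ / 2 := by
      calc R * |x - x₀| ^ β ≤ R * (1 / (2 * R) * f x₀) := by gcongr
        _ = f x₀ / 2 := by field_simp
    have := (abs_le.1 (h1.trans h3)).1
    linarith
  · have hβi : 0 < β⁻¹ := inv_pos.2 hβ
    have hhalf : (1 / 2 : ℝ) ^ β⁻¹ < 1 := Real.rpow_lt_one (by norm_num) (by norm_num) hβi
    have hL : 0 < R ^ β⁻¹ := by positivity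
    -- Chosen so that `f ^ (1/β)`, with Lipschitz constant `R ^ (1/β)`, keeps the fraction `(1/2) ^
    -- (1/β)` of its value.
    refine ⟨(1 - (1 / 2 : ℝ) ^ β⁻¹) / R ^ β⁻¹, div_pos (by linarith) hL,
      fun f hf hfR x₀ hx₀ x hx hd => ?_⟩
    have h1 := rpow_sub_rpow_le_of_flatSeminorm_le hβ1 hR.le hf (le_add_self.trans hfR) hx hx₀
    have h2 : R ^ β⁻¹ * |x - x₀| ≤ (1 - (1 / 2 : ℝ) ^ β⁻¹) * f x₀ ^ β⁻¹ := by
      calc R ^ β⁻¹ * |x - x₀| ≤ R ^ β⁻¹ * ((1 - (1 / 2 : ℝ) ^ β⁻¹) / R ^ β⁻¹ * f x₀ ^ β⁻¹) := by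
            gcongr
        _ = _ := by field_simp
    have h3 : (1 / 2 * f x₀) ^ β⁻¹ ≤ f x ^ β⁻¹ := by
      rw [Real.mul_rpow (by norm_num) (hf.nonneg x₀ hx₀)]
      linarith
    have := (Real.rpow_le_rpow_iff (mul_nonneg (by norm_num) (hf.nonneg x₀ hx₀))
      (hf.nonneg x hx) hβi).1 h3
    linarith

theorem MemFlat.le_of_flatNorm_le {β R : ℝ} {f : ℝ → ℝ} (hf : MemFlat β f) (hR : 0 ≤ R)
    (hfR : flatNorm β f ≤ ENNReal.ofReal R) {x : ℝ} (hx : x ∈ Set.Icc (0 : ℝ) 1) : f x ≤ R := by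
  have h1 : ‖f x‖ₑ ≤ supNorm f := by
    rw [supNorm]
    exact le_iSup₂_of_le x hx le_rfl
  have h2 : supNorm f ≤ flatNorm β f := by
    rw [flatNorm, holderNorm, add_assoc, add_assoc]
    exact le_self_add
  have h3 := (h1.trans h2).trans hfR
  rwa [Real.enorm_eq_ofReal (hf.nonneg x hx), ENNReal.ofReal_le_ofReal_iff hR] at h3

/-! ### Effect of bumps on the logarithm -/

/-- Adding `p` can only soften the singularity of the logarithm at zero, and `f + p` is bounded
above on `[0, 1]`. -/
theorem IsLogDrift.add_of_nonneg {f p : ℝ → ℝ} (hf : IsLogDrift f)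
    (hfc : ContinuousOn f (Set.Icc 0 1)) (hpc : Continuous p) (hp : ∀ x, 0 ≤ p x) :
    IsLogDrift (f + p) := by
  have hc : ContinuousOn (f + p) (Set.Icc 0 1) := hfc.add hpc.continuousOn
  obtain ⟨B, hB⟩ := (isCompact_Icc (a := (0 : ℝ)) (b := 1)).exists_bound_of_continuousOn hc
  refine ⟨hf.pos.mono fun x hx => add_pos_of_pos_of_nonneg hx (hp x), ?_⟩
  have hmaj : MemLp (fun x => |Real.log (f x)| + |B|) 2 (volume.restrict (Set.Icc (0 : ℝ) 1)) :=
    hf.memLp.norm.add (memLp_const _)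
  refine hmaj.mono ?_ ?_
  · exact (Real.measurable_log.comp_aemeasurable
      (hc.aestronglyMeasurable measurableSet_Icc).aemeasurable).aestronglyMeasurable
  · filter_upwards [hf.pos, ae_restrict_mem measurableSet_Icc] with x hx hxI
    have hle : f x ≤ (f + p) x := le_add_of_nonneg_right (hp x)
    have h1 : Real.log (f x) ≤ Real.log ((f + p) x) := Real.log_le_log hx hle
    have h2 : Real.log ((f + p) x) ≤ |B| := by
      have h3 := Real.log_le_sub_one_of_pos (hx.trans_le hle)
      have h4 := (le_abs_self _).trans (hB x hxI)
      linarith [le_abs_self B]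
    rw [Real.norm_eq_abs, Real.norm_eq_abs, abs_of_nonneg (by positivity : (0 : ℝ) ≤ _ + |B|),
      abs_le]
    constructor
    · linarith [neg_abs_le (Real.log (f x)), abs_nonneg B]
    · linarith [abs_nonneg (Real.log (f x))]

theorem logDistSq_comm (f g : ℝ → ℝ) : logDistSq f g = logDistSq g f := by
  simp only [logDistSq, ← neg_sub (Real.log (f _)), neg_sq]

theorem logDistSq_le_add {f g k : ℝ → ℝ} (hf : IsLogDrift f) (hg : IsLogDrift g)
    (hk : IsLogDrift k) : logDistSq f k ≤ 2 * logDistSq f g + 2 * logDistSq g k := by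
  have hint : ∀ {f g : ℝ → ℝ}, IsLogDrift f → IsLogDrift g → Integrable
      (fun x => (Real.log (f x) - Real.log (g x)) ^ 2) (volume.restrict (Set.Icc (0 : ℝ) 1)) :=
    fun hf hg => (hf.memLp.sub hg.memLp).integrable_sq
  have h1 := hint hf hg
  have h2 := hint hg hk
  have h3 := hint hf hk
  rw [logDistSq, logDistSq, logDistSq, ← integral_const_mul, ← integral_const_mul,
    ← integral_add (h1.const_mul 2) (h2.const_mul 2)]
  refine integral_mono h3 ((h1.const_mul 2).add (h2.const_mul 2)) fun x => ?_
  simp only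
  nlinarith [sq_nonneg (Real.log (f x) - Real.log (g x) - (Real.log (g x) - Real.log (k x)))]

theorem logDistSq_self (f : ℝ → ℝ) : logDistSq f f = 0 := by simp [logDistSq]

/-- A bump of height `a` on an interval of radius `h` where the function is at least `y / 2`. -/
theorem logDistSq_add_le {f p : ℝ → ℝ} {x₀ y a h : ℝ} (hy : 0 < y) (hh : 0 < h)
    (hp0 : ∀ x, 0 ≤ p x) (hpa : ∀ x, p x ≤ a) (hpz : ∀ x, h ≤ |x - x₀| → p x = 0)
    (hf : ∀ x ∈ Set.Icc (0 : ℝ) 1, |x - x₀| < h → y / 2 ≤ f x) :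
    logDistSq (f + p) f ≤ (2 * a / y) ^ 2 * (2 * h) := by
  have hpt : ∀ x ∈ Set.Icc (0 : ℝ) 1, (Real.log ((f + p) x) - Real.log (f x)) ^ 2 ≤
      (Metric.ball x₀ h).indicator (fun _ => (2 * a / y) ^ 2) x := by
    intro x hx
    rcases lt_or_ge |x - x₀| h with hd | hd
    · rw [Set.indicator_of_mem (by rwa [Metric.mem_ball, Real.dist_eq])]
      have hfx := hf x hx hd
      have hf0 : 0 < f x := by linarith
      have h1 : 0 ≤ Real.log ((f + p) x) - Real.log (f x) :=
        sub_nonneg.2 (Real.log_le_log hf0 (le_add_of_nonneg_right (hp0 x)))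
      -- This is `log (1 + p / f) ≤ p / f` with `p ≤ a` and `f ≥ y / 2`.
      have h2 : Real.log ((f + p) x) - Real.log (f x) ≤ 2 * a / y := by
        rw [← Real.log_div (by simp only [Pi.add_apply]; linarith [hp0 x]) hf0.ne']
        refine (Real.log_le_sub_one_of_pos (div_pos (by
          simp only [Pi.add_apply]; linarith [hp0 x]) hf0)).trans ?_
        rw [Pi.add_apply, add_div, div_self hf0.ne', add_sub_cancel_left,
          div_le_div_iff₀ hf0 hy]
        nlinarith [hp0 x, hpa x]
      gcongr
    · rw [Set.indicator_of_notMem (by rw [Metric.mem_ball, Real.dist_eq]; exact not_lt.2 hd)]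
      simp [hpz x hd]
  have hint : IntegrableOn ((Metric.ball x₀ h).indicator fun _ => (2 * a / y) ^ 2)
      (Set.Icc (0 : ℝ) 1) := by
    refine Integrable.integrableOn ?_
    rw [integrable_indicator_iff Metric.isOpen_ball.measurableSet]
    exact integrableOn_const measure_ball_lt_top.ne
  calc logDistSq (f + p) f
      ≤ ∫ x in Set.Icc (0 : ℝ) 1, (Metric.ball x₀ h).indicator (fun _ => (2 * a / y) ^ 2) x :=
        integral_mono_of_nonneg (ae_of_all _ fun x => sq_nonneg _) hint
          ((ae_restrict_mem measurableSet_Icc).mono hpt)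
    _ ≤ ∫ x, (Metric.ball x₀ h).indicator (fun _ => (2 * a / y) ^ 2) x := by
        refine setIntegral_le_integral ?_ (ae_of_all _ fun x => ?_)
        · rw [integrable_indicator_iff Metric.isOpen_ball.measurableSet]
          exact integrableOn_const measure_ball_lt_top.ne
        · exact Set.indicator_nonneg (fun _ _ => sq_nonneg _) x
    _ = _ := by
        rw [integral_indicator Metric.isOpen_ball.measurableSet, setIntegral_const,
          measureReal_def, Real.volume_ball, ENNReal.toReal_ofReal (by linarith), smul_eq_mul,
          mul_comm]

/-- At a zero of `f`, sufficiently narrow bumps change `log f` by an arbitrarily small amount. -/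
theorem eventually_logDistSq_add_le {f : ℝ → ℝ} (hf : IsLogDrift f)
    (hfc : ContinuousOn f (Set.Icc 0 1)) {x₀ : ℝ} (hx₀ : x₀ ∈ Set.Icc (0 : ℝ) 1)
    (h0 : f x₀ = 0) {τ : ℝ} (hτ : 0 < τ) :
    ∀ᶠ h in 𝓝[>] (0 : ℝ), ∀ p : ℝ → ℝ, (∀ x, 0 ≤ p x) → (∀ x, p x ≤ 1 / 2) →
      (∀ x, h ≤ |x - x₀| → p x = 0) → logDistSq (f + p) f ≤ τ := by
  have hint : Integrable (fun x => Real.log (f x) ^ 2) (volume.restrict (Set.Icc (0 : ℝ) 1)) :=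
    hf.memLp.integrable_sq
  -- Near the zero `f + p ≤ 1`, so `log f ≤ log (f + p) ≤ 0` and the squared change is at most `(log
  -- f) ^ 2`, whose integral over shrinking balls vanishes.
  have hlim : Tendsto (fun h : ℝ => ∫ x in Metric.ball x₀ h, Real.log (f x) ^ 2
      ∂(volume.restrict (Set.Icc (0 : ℝ) 1))) (𝓝[>] 0) (𝓝 0) := by
    refine hint.tendsto_setIntegral_nhds_zero ?_
    have h1 : Tendsto (fun h : ℝ => ENNReal.ofReal (2 * h)) (𝓝[>] 0) (𝓝 0) := by
      have : Continuous fun h : ℝ => ENNReal.ofReal (2 * h) :=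
        ENNReal.continuous_ofReal.comp (continuous_const.mul continuous_id)
      have := this.tendsto 0
      simp only [mul_zero, ENNReal.ofReal_zero] at this
      exact this.mono_left nhdsWithin_le_nhds
    refine tendsto_of_tendsto_of_tendsto_of_le_of_le tendsto_const_nhds h1
      (fun _ => zero_le) fun h => ?_
    exact (Measure.restrict_apply_le _ _).trans (by rw [Real.volume_ball])
  obtain ⟨r, hr, hball⟩ : ∃ r > 0, ∀ x ∈ Set.Icc (0 : ℝ) 1, |x - x₀| < r → f x ≤ 1 / 2 := by
    obtain ⟨r, hr, h⟩ := Metric.continuousWithinAt_iff.1 (hfc x₀ hx₀) (1 / 2) (by norm_num)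
    refine ⟨r, hr, fun x hx hd => ?_⟩
    have := h hx (by rwa [Real.dist_eq])
    rw [h0, Real.dist_eq, sub_zero] at this
    exact (le_abs_self _).trans this.le
  filter_upwards [hlim.eventually (gt_mem_nhds hτ), Ioo_mem_nhdsGT hr] with h hh hhr p hp0 hp1 hpz
  refine le_trans ?_ hh.le
  rw [← integral_indicator Metric.isOpen_ball.measurableSet]
  refine integral_mono_of_nonneg (ae_of_all _ fun x => sq_nonneg _)
    (hint.indicator Metric.isOpen_ball.measurableSet) ?_
  filter_upwards [hf.pos, ae_restrict_mem measurableSet_Icc] with x hfx hx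
  rcases lt_or_ge |x - x₀| h with hd | hd
  · rw [Set.indicator_of_mem (by rwa [Metric.mem_ball, Real.dist_eq])]
    have h1 : Real.log (f x) ≤ Real.log ((f + p) x) :=
      Real.log_le_log hfx (le_add_of_nonneg_right (hp0 x))
    have h2 : Real.log ((f + p) x) ≤ 0 := by
      refine Real.log_nonpos (add_nonneg hfx.le (hp0 x)) ?_
      have := hball x hx (hd.trans hhr.2)
      have := hp1 x
      simp only [Pi.add_apply]
      linarith
    nlinarith
  · rw [Set.indicator_of_notMem (by rw [Metric.mem_ball, Real.dist_eq]; exact not_lt.2 hd)]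
    simp [hpz x hd]

/-! ### Rate inequalities and construction of competitors -/

theorem rate_pos {n : ℕ} (hn : n ≠ 0) (β : ℝ) {y : ℝ} (hy : 0 < y) : 0 < rate n β y := by
  have : (0 : ℝ) < n := by positivity
  exact lt_min hy (by positivity)

theorem rate_le (n : ℕ) (β y : ℝ) : rate n β y ≤ y := min_le_left _ _

/-- The exponent of `y ^ 2` is below `1/2`, so doubling `y` at most doubles the rate; hence the
rates at the two competing values are comparable. -/
theorem rate_le_two_mul {n : ℕ} {β y z : ℝ} (hβ : 0 < β) (hy : 0 ≤ y) (hz : 0 ≤ z)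
    (hzy : z ≤ 2 * y) : rate n β z ≤ 2 * rate n β y := by
  have he : 0 ≤ β / (2 * β + 1) := by positivity
  rw [rate, rate, mul_min_of_nonneg _ _ zero_le_two]
  refine min_le_min hzy ?_
  have h4 : (4 : ℝ) ^ (β / (2 * β + 1)) ≤ 2 := by
    rw [show (4 : ℝ) = 2 ^ (2 : ℝ) by norm_num, ← Real.rpow_mul zero_le_two]
    conv_rhs => rw [← Real.rpow_one 2]
    refine Real.rpow_le_rpow_of_exponent_le one_le_two ?_
    rw [← mul_div_assoc, div_le_one (by positivity)]
    linarith
  calc (z ^ 2 / n) ^ (β / (2 * β + 1)) ≤ (4 * (y ^ 2 / n)) ^ (β / (2 * β + 1)) := by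
        refine Real.rpow_le_rpow (by positivity) ?_ he
        rw [← mul_div_assoc]
        gcongr
        nlinarith
    _ = 4 ^ (β / (2 * β + 1)) * (y ^ 2 / n) ^ (β / (2 * β + 1)) :=
        Real.mul_rpow (by norm_num) (by positivity)
    _ ≤ 2 * (y ^ 2 / n) ^ (β / (2 * β + 1)) := by gcongr

/-- The second branch of the minimum solves this as an equation. It bounds the information `n r ^ 2
h / y ^ 2` of a bump of height `r` and width `h = r ^ (1/β)`. -/
theorem rate_rpow_le {n : ℕ} {β y : ℝ} (hn : n ≠ 0) (hβ : 0 < β) (hy : 0 < y) :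
    rate n β y ^ 2 * rate n β y ^ β⁻¹ ≤ y ^ 2 / n := by
  have hr := rate_pos hn β hy
  have hle : rate n β y ≤ (y ^ 2 / n) ^ (β / (2 * β + 1)) := min_le_right _ _
  have hexp : 0 ≤ (2 * β + 1) / β := by positivity
  calc rate n β y ^ 2 * rate n β y ^ β⁻¹ = rate n β y ^ ((2 * β + 1) / β) := by
        rw [← Real.rpow_natCast, ← Real.rpow_add hr]
        congr 1
        push_cast
        field_simp
    _ ≤ ((y ^ 2 / n) ^ (β / (2 * β + 1))) ^ ((2 * β + 1) / β) := by gcongr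
    _ = y ^ 2 / n := by
        rw [← Real.rpow_mul (by positivity), div_mul_div_cancel₀ (by positivity), div_self hβ.ne',
          Real.rpow_one]

/-- The members of the parameter space of radius `R`. -/
def IsParameter (β R : ℝ) (f : ℝ → ℝ) : Prop :=
  MemFlat β f ∧ IsLogDrift f ∧ flatNorm β f ≤ ENNReal.ofReal R

/-- Every parameter has a positive competitor at `x₀` of almost the same norm that is statistically
close. -/
theorem exists_positive_parameter {β R R' : ℝ} (hβ : 0 < β) (hR : 0 ≤ R) (hRR' : R < R')
    {g : ℝ → ℝ} (hg : IsParameter β R g) {x₀ : ℝ} (hx₀ : x₀ ∈ Set.Icc (0 : ℝ) 1) {τ : ℝ}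
    (hτ : 0 < τ) : ∃ f, IsParameter β R' f ∧ 0 < f x₀ ∧ logDistSq f g ≤ τ := by
  obtain ⟨hgm, hgl, hgR⟩ := hg
  rcases (hgm.nonneg x₀ hx₀).eq_or_lt with h0 | h0
  swap
  · exact ⟨g, ⟨hgm, hgl, hgR.trans (ENNReal.ofReal_le_ofReal hRR'.le)⟩, h0,
      by rw [logDistSq_self]; exact hτ.le⟩
  obtain ⟨K, M, hM, hK⟩ := exists_flatBump hβ
  obtain ⟨ε, hε, hε1, hpert⟩ := hK.exists_perturbation hβ hM hR (sub_pos.2 hRR')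
  have hcont := hgm.contDiffOn.continuousOn
  have hhalf : ∀ᶠ h : ℝ in 𝓝[>] 0, h ^ β < 1 / 2 := by
    have h1 : Continuous fun h : ℝ => h ^ β := continuous_id.rpow_const fun _ => Or.inr hβ.le
    have h2 := h1.tendsto 0
    rw [Real.zero_rpow hβ.ne'] at h2
    exact (h2.mono_left nhdsWithin_le_nhds).eventually (gt_mem_nhds (by norm_num))
  obtain ⟨h, hd, hh2, hh0, hh1⟩ := ((eventually_logDistSq_add_le hgl hcont hx₀ h0.symm hτ).and
    (hhalf.and (Ioo_mem_nhdsGT (zero_lt_one (α := ℝ))))).exists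
  have ha : 0 < ε * h ^ β := by positivity
  obtain ⟨h1, h2⟩ := hpert g hgm hgR x₀ h hh0 hh1.le
  have hp0 := hK.scaledBump_nonneg (x₀ := x₀) (h := h) ha.le
  refine ⟨g + scaledBump K x₀ (ε * h ^ β) h, ⟨h1, hgl.add_of_nonneg hcont
    (hK.contDiff_scaledBump _ _ _).continuous hp0, ?_⟩, ?_, hd _ hp0 (fun x => ?_)
    (fun x => hK.scaledBump_eq_zero hh0)⟩
  · refine (h2.trans (add_le_add_left hgR _)).trans_eq ?_
    rw [← ENNReal.ofReal_add hR (sub_pos.2 hRR').le, add_sub_cancel]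
  · rw [Pi.add_apply, hK.scaledBump_self, ← h0, zero_add]
    exact ha
  · refine (hK.scaledBump_le ha.le x).trans ?_
    nlinarith

/-- Every parameter which is positive at `x₀` has a statistically close competitor, separated by the
rate at `x₀`. -/
theorem exists_separated_parameter {β R R' : ℝ} (hβ : 0 < β) (hR : 0 < R) (hRR' : R < R') :
    ∃ C : ℝ, 0 < C ∧ ∀ n : ℕ, n ≠ 0 → ∀ x₀ ∈ Set.Icc (0 : ℝ) 1, ∀ f, IsParameter β R f →
      0 < f x₀ → ∃ g, IsParameter β R' g ∧ n / 4 * logDistSq g f ≤ 1 / 4 ∧ 0 < g x₀ ∧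
        C * (rate n β (f x₀) + rate n β (g x₀)) ≤ |f x₀ - g x₀| := by
  obtain ⟨K, M, hM, hK⟩ := exists_flatBump hβ
  obtain ⟨ε, hε, hε1, hpert⟩ := hK.exists_perturbation hβ hM hR.le (sub_pos.2 hRR')
  obtain ⟨c, hc, hloc⟩ := exists_half_le_of_flatNorm_le hβ hR
  -- The three bounds give, in order, information `2 κ ≤ 1/4`, a bump supported where `f ≥ y / 2`,
  -- and width at most `1`.
  set κ : ℝ := min (1 / 8) (min c (R ^ β⁻¹)⁻¹) with hκ
  have hκ0 : 0 < κ := by positivity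
  have hκ1 : κ ≤ 1 / 8 := min_le_left _ _
  have hκc : κ ≤ c := (min_le_right _ _).trans (min_le_left _ _)
  have hκR : κ * R ^ β⁻¹ ≤ 1 := by
    rw [← le_div_iff₀ (by positivity), one_div]
    exact (min_le_right _ _).trans (min_le_right _ _)
  -- The bump height is `ε κ ^ β r`, while the two rates sum to at most `r + 2 r`.
  refine ⟨ε * κ ^ β / 3, by positivity, fun n hn x₀ hx₀ f ⟨hfm, hfl, hfR⟩ hy => ?_⟩
  set y := f x₀ with hydef
  set r := rate n β y
  have hn0 : (0 : ℝ) < n := by positivity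
  have hr : 0 < r := rate_pos hn β hy
  have hry : r ≤ y := rate_le n β y
  have hβi : 0 < β⁻¹ := inv_pos.2 hβ
  have hry' : r ^ β⁻¹ ≤ y ^ β⁻¹ := Real.rpow_le_rpow hr.le hry hβi.le
  set h := κ * r ^ β⁻¹ with hhdef
  have hh : 0 < h := by positivity
  have hyR : y ^ β⁻¹ ≤ R ^ β⁻¹ :=
    Real.rpow_le_rpow hy.le (hfm.le_of_flatNorm_le hR.le hfR hx₀) hβi.le
  have hh1 : h ≤ 1 := (mul_le_mul_of_nonneg_left (hry'.trans hyR) hκ0.le).trans hκR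
  have hhy : h ≤ c * y ^ β⁻¹ := by rw [hhdef]; gcongr
  have hhβ : h ^ β = κ ^ β * r := by
    rw [hhdef, Real.mul_rpow hκ0.le (by positivity), ← Real.rpow_mul hr.le,
      inv_mul_cancel₀ hβ.ne', Real.rpow_one]
  have hκβ : κ ^ β ≤ 1 := Real.rpow_le_one hκ0.le (by linarith) hβ.le
  set a := ε * h ^ β with hadef
  have ha : 0 < a := by positivity
  have har : a ≤ r := by
    rw [hadef, hhβ, ← mul_assoc]
    exact mul_le_of_le_one_left hr.le (mul_le_one₀ hε1 (by positivity) hκβ)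
  have hp0 := hK.scaledBump_nonneg (x₀ := x₀) (h := h) ha.le
  obtain ⟨hm, hnorm⟩ := hpert f hfm hfR x₀ h hh hh1
  have hval : (f + scaledBump K x₀ a h) x₀ = y + a := by
    rw [Pi.add_apply, hK.scaledBump_self]
  refine ⟨f + scaledBump K x₀ a h, ⟨hm, hfl.add_of_nonneg hfm.contDiffOn.continuousOn
    (hK.contDiff_scaledBump _ _ _).continuous hp0, ?_⟩, ?_, ?_, ?_⟩
  · refine (hnorm.trans (add_le_add_left hfR _)).trans_eq ?_
    rw [← ENNReal.ofReal_add hR.le (sub_pos.2 hRR').le, add_sub_cancel]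
  · have hd := logDistSq_add_le hy hh hp0 (hK.scaledBump_le ha.le)
      (fun x => hK.scaledBump_eq_zero hh) (fun x hx hd => hloc f hfm hfR x₀ hx₀ x hx
        (hd.le.trans hhy))
    have hrr : r ^ 2 * r ^ β⁻¹ ≤ y ^ 2 / n := rate_rpow_le hn hβ hy
    have har2 : a ^ 2 * h ≤ κ * (y ^ 2 / n) := by
      calc a ^ 2 * h ≤ r ^ 2 * h := by gcongr
        _ = κ * (r ^ 2 * r ^ β⁻¹) := by rw [hhdef]; ring
        _ ≤ _ := by gcongr
    calc n / 4 * logDistSq (f + scaledBump K x₀ a h) f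
        ≤ n / 4 * ((2 * a / y) ^ 2 * (2 * h)) := by gcongr
      _ = 2 * n / y ^ 2 * (a ^ 2 * h) := by field_simp; ring
      _ ≤ 2 * n / y ^ 2 * (κ * (y ^ 2 / n)) := by gcongr
      _ = 2 * κ := by field_simp
      _ ≤ 1 / 4 := by linarith
  · rw [hval]; linarith
  · rw [hval, sub_add_cancel_left, abs_neg, abs_of_pos ha]
    have h2 : rate n β (y + a) ≤ 2 * r :=
      rate_le_two_mul hβ hy.le (by linarith) (by linarith)
    calc ε * κ ^ β / 3 * (rate n β y + rate n β (y + a))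
        ≤ ε * κ ^ β / 3 * (r + 2 * r) := by gcongr
      _ = a := by rw [hadef, hhβ]; ring

/-! ### Le Cam's bound and conclusion -/

section LowerBound

variable {Ω : Type*} [MeasurableSpace Ω] {P : Measure Ω} [IsProbabilityMeasure P]
  {W : ℝ≥0 → Ω → ℝ} {n : ℕ} {β R : ℝ} {f g k : ℝ → ℝ}

theorem mem_localSpace (hW : ∀ t, Measurable (W t)) (hB : IsPreBrownianReal W P) (hn : n ≠ 0)
    (hf : IsParameter β R f) (hg : IsLogDrift g) (hd : n / 4 * logDistSq f g ≤ 1) :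
    f ∈ localSpace P W β R n g := by
  refine ⟨hf.1, hf.2.1, hf.2.2, (klDiv_pathLaw_le hW hB hn hf.2.1 hg).trans ?_⟩
  rw [← ENNReal.ofReal_one]
  exact ENNReal.ofReal_le_ofReal hd

/-- Le Cam's two point bound. -/
theorem one_fourth_le_iSup_pathLaw (hW : ∀ t, Measurable (W t)) (hB : IsPreBrownianReal W P)
    (hn : n ≠ 0) (hf : f ∈ localSpace P W β R n k) (hg : g ∈ localSpace P W β R n k)
    (hd : n / 4 * logDistSq g f ≤ 1 / 4) {x₀ C : ℝ} (hfx : 0 < f x₀) (hgx : 0 < g x₀)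
    (hsep : C * (rate n β (f x₀) + rate n β (g x₀)) ≤ |f x₀ - g x₀|)
    {T : (unitInterval → ℝ) → ℝ} (hT : Measurable T) :
    1 / 4 ≤ ⨆ f ∈ localSpace P W β R n k,
      pathLaw P W n f {y | C ≤ |T y - f x₀| / rate n β (f x₀)} := by
  have hprob : ∀ f, IsProbabilityMeasure (pathLaw P W n f) := fun f =>
    Measure.isProbabilityMeasure_map (measurable_observation hW n f).aemeasurable
  set A : (ℝ → ℝ) → Set (unitInterval → ℝ) :=
    fun f => {y | C ≤ |T y - f x₀| / rate n β (f x₀)} with hA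
  have hAm : ∀ f, MeasurableSet (A f) := fun f =>
    measurableSet_le measurable_const (((hT.sub_const _).abs).div_const _)
  -- An estimate close to both values would contradict their separation.
  have hsub : (A f)ᶜ ⊆ A g := by
    intro y hy
    by_contra hy'
    simp only [hA, Set.mem_compl_iff, Set.mem_ofPred_eq, not_le] at hy hy'
    rw [div_lt_iff₀ (rate_pos hn β hfx)] at hy
    rw [div_lt_iff₀ (rate_pos hn β hgx)] at hy'
    have := abs_sub_le (f x₀) (T y) (g x₀)
    rw [abs_sub_comm (f x₀) (T y)] at this
    linarith
  -- Hence the two error probabilities sum to at least `1/2`, and one of them is at least `1/4`.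
  have hle := pathLaw_real_le hW hB hn hf.2.1 hg.2.1 (by rwa [logDistSq_comm]) (hAm f).compl
  have hle2 : (pathLaw P W n g).real (A f)ᶜ ≤ (pathLaw P W n g).real (A g) :=
    measureReal_mono hsub
  rw [probReal_compl_eq_one_sub (hAm f)] at hle
  have hsup : ∀ {f}, f ∈ localSpace P W β R n k → 1 / 4 ≤ (pathLaw P W n f).real (A f) →
      1 / 4 ≤ ⨆ f ∈ localSpace P W β R n k, pathLaw P W n f (A f) := by
    intro f hf h
    refine le_trans ?_ (le_iSup₂_of_le f hf le_rfl)
    have := ENNReal.ofReal_le_ofReal h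
    rw [ofReal_measureReal] at this
    refine le_trans (le_of_eq ?_) this
    rw [ENNReal.ofReal_div_of_pos (by norm_num)]
    simp
  rcases le_or_gt (1 / 4) ((pathLaw P W n f).real (A f)) with h | h
  · exact hsup hf h
  · exact hsup hg (by linarith)

end LowerBound

end LogLinkModel

theorem theorem7 (β R ρ : ℝ) (hβ : 0 < β) (hR : 0 < R) (hρ : ρ < R) :
    ∃ C : ℝ, 0 < C ∧
      ∀ (Ω : Type*) [MeasurableSpace Ω] (P : Measure Ω) [IsProbabilityMeasure P]
        (W : ℝ≥0 → Ω → ℝ), (∀ t, Measurable (W t)) → IsBrownianReal W P →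
      ∀ x₀ ∈ Set.Icc (0 : ℝ) 1, ∀ fstar : ℕ → ℝ → ℝ,
        (∀ n, LogLinkModel.MemFlat β (fstar n) ∧ LogLinkModel.IsLogDrift (fstar n)) →
        limsup (fun n => LogLinkModel.flatNorm β (fstar n)) atTop ≤ ENNReal.ofReal ρ →
        0 < liminf (fun n : ℕ =>
          ⨅ (T : (unitInterval → ℝ) → ℝ) (_ : Measurable T),
            ⨆ f ∈ LogLinkModel.localSpace P W β R n (fstar n),
              LogLinkModel.pathLaw P W n f
                {y | C ≤ |T y - f x₀| / LogLinkModel.rate n β (f x₀)}) atTop := by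
  -- The norm budget is spent in two stages: the centre below `ρ₁`, the positive competitor within
  -- `ρ₂`, the separated one within `R`. The maximum covers negative `ρ`.
  obtain ⟨ρ₁, hρ₁, hρ₁R⟩ : ∃ ρ₁, max ρ 0 < ρ₁ ∧ ρ₁ < R := exists_between (max_lt hρ hR)
  obtain ⟨ρ₂, hρ₁₂, hρ₂R⟩ := exists_between hρ₁R
  have hρ₁0 : 0 < ρ₁ := (le_max_right _ _).trans_lt hρ₁
  obtain ⟨C, hC, hsep⟩ := LogLinkModel.exists_separated_parameter hβ (hρ₁0.trans hρ₁₂) hρ₂R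
  refine ⟨C, hC, fun Ω _ P _ W hW hB x₀ hx₀ fstar hf hlim => ?_⟩
  have hev : ∀ᶠ n in atTop, LogLinkModel.flatNorm β (fstar n) < ENNReal.ofReal ρ₁ :=
    eventually_lt_of_limsup_lt (hlim.trans_lt
      ((ENNReal.ofReal_lt_ofReal_iff hρ₁0).2 ((le_max_left _ _).trans_lt hρ₁)))
  refine lt_of_lt_of_le (by norm_num : (0 : ℝ≥0∞) < 1 / 4) (le_liminf_of_le (by isBoundedDefault) ?_)
  filter_upwards [hev, eventually_ne_atTop 0] with n hn hn0
  have hn' : (0 : ℝ) < n := by positivity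
  -- Positivity at `x₀` is needed: at a zero the rate is `0`, the quotient is `0` by convention, and
  -- the error event is empty.
  obtain ⟨f₀, hf₀, hf₀x, hd₀⟩ := LogLinkModel.exists_positive_parameter hβ hρ₁0.le hρ₁₂
    ⟨(hf n).1, (hf n).2, hn.le⟩ hx₀ (τ := 1 / n) (by positivity)
  obtain ⟨f₁, hf₁, hd₁, hf₁x, hsep⟩ := hsep n hn0 x₀ hx₀ f₀ hf₀ hf₀x
  have hd₀' : n / 4 * LogLinkModel.logDistSq f₀ (fstar n) ≤ 1 / 4 := by
    calc n / 4 * LogLinkModel.logDistSq f₀ (fstar n) ≤ n / 4 * (1 / n) := by gcongr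
      _ = 1 / 4 := by field_simp
  have hf₀R : LogLinkModel.IsParameter β R f₀ :=
    ⟨hf₀.1, hf₀.2.1, hf₀.2.2.trans (ENNReal.ofReal_le_ofReal hρ₂R.le)⟩
  have hmem₀ := LogLinkModel.mem_localSpace hW hB.toIsPreBrownianReal hn0 hf₀R (hf n).2 (by linarith)
  -- The squared triangle inequality gives `2 (1/4 + 1/4) = 1`, exactly the divergence allowed.
  have hmem₁ := LogLinkModel.mem_localSpace hW hB.toIsPreBrownianReal hn0 hf₁ (hf n).2 (by
    have := LogLinkModel.logDistSq_le_add hf₁.2.1 hf₀.2.1 (hf n).2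
    have : n / 4 * LogLinkModel.logDistSq f₁ (fstar n) ≤
        n / 4 * (2 * LogLinkModel.logDistSq f₁ f₀ + 2 * LogLinkModel.logDistSq f₀ (fstar n)) := by gcongr
    linarith)
  exact le_iInf₂ fun T hT => LogLinkModel.one_fourth_le_iSup_pathLaw hW hB.toIsPreBrownianReal hn0 hmem₀ hmem₁
    hd₁ hf₀x hf₁x hsep hT
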